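/- All graphs are finite and simple; $\overline{G}$ denotes the complement of $G$, $P_5$ the path on five vertices, and $C_5$ (the *pentagon*) the cycle on five vertices. A graph is $H$-*free* if it has no induced subgraph isomorphic to $H$, and $\{P_5,\overline{P_5}\}$-*free* if it is both $P_5$-free and $\overline{P_5}$-free. A graph is *split* if its vertex-set can be partitioned into a (possibly empty) clique and a (possibly empty) stable set. A graph $H$ is *smaller* than $G$ if it has strictly fewer vertices than $G$. A set $X$ is *complete* (*anti-complete*) to a disjoint set $Y$ if every vertex of $X$ is adjacent (non-adjacent) to every vertex of $Y$. Graphs are considered up to isomorphism. *Substitution.* Given graphs $G_1,G_2$ with disjoint vertex-sets and $u\in V_{G_2}$, a graph $G$ is obtained by substituting $G_1$ for $u$ in $G_2$ if $V_G=V_{G_1}\cup(V_{G_2}\setminus\{u\})$, $G[V_{G_1}]=G_1$, $G[V_{G_2}\setminus\{u\}]=G_2\setminus u$, and every $v\in V_{G_2}\setminus\{u\}$ is complete to $V_{G_1}$ in $G$ if $v$ is adjacent to $u$ in $G_2$, and anti-complete to $V_{G_1}$ in $G$ otherwise. *Split graph unification.* Let $A,B,C,L,T$ be pairwise disjoint sets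 with $A,C$ non-empty, and let $a\neq c$ be vertices not in $A\cup B\cup C\cup L\cup T$. Let $G_1$ be a graph with $V_{G_1}=A\cup L\cup T\cup\{c\}$ in which $L$ is a clique, $T$ is a stable set, $A$ is anti-complete to $T$, and $c$ is complete to $L$ and anti-complete to $A\cup T$. Let $G_2$ be a graph with $V_{G_2}=B\cup C\cup L\cup T\cup\{a\}$ such that $G_2[L\cup T]=G_1[L\cup T]$, $T$ is anti-complete to $C$, $L$ is complete to $B\cup C$, and $a$ is complete to $B$ and anti-complete to $C\cup L\cup T$. Then $(G_1,G_2)$ is a *composable pair*, and its split graph unification is the graph $G$ with $V_G=A\cup B\cup C\cup L\cup T$ such that $G[A\cup L\cup T]=G_1\setminus c$, $G[B\cup C\cup L\cup T]=G_2\setminus a$, and $A$ is complete to $B$ and anti-complete to $C$ in $G$. **Theorem.** A graph $G$ is $\{P_5,\overline{P_5}\}$-free if and only if at least one of the following holds: - $G$ is a split graph; - $G$ is a pentagon; - $G$ is obtained by substituting $G_1$ for a vertex of $G_2$, for some $\{P_5,\overline{P_5}\}$-free graphs $G_1,G_2$ smaller than $G$; - $G$ or $\overline{G}$ is the split graph unification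 of a composable pair $(G_1,G_2)$ of $\{P_5,\overline{P_5}\}$-free graphs smaller than $G$. -/

import Mathlib

namespace P5House

universe u

section AbstractGraphs

variable {V W : Type*}

/-- `G` is `H`-free: no induced subgraph of `G` is isomorphic to `H`. -/
def IsFree (H : SimpleGraph W) (G : SimpleGraph V) : Prop := ¬ H.IsIndContained G

/-- `G` is `{P₅, complement of P₅}`-free; `P₅` is the path on five vertices. -/
def IsP5HouseFree (G : SimpleGraph V) : Prop :=
  IsFree (SimpleGraph.pathGraph 5) G ∧ IsFree (SimpleGraph.pathGraph 5)ᶜ G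

/-- The vertex-set is partitioned into a (possibly empty) clique `K` and a (possibly empty)
stable set `S`. -/
def IsSplit (G : SimpleGraph V) : Prop :=
  ∃ K S : Set V, Disjoint K S ∧ K ∪ S = Set.univ ∧ G.IsClique K ∧ G.IsIndepSet S

/-- `G` is (isomorphic to) the cycle on five vertices. -/
def IsPentagon (G : SimpleGraph V) : Prop := Nonempty (G ≃g SimpleGraph.cycleGraph 5)

end AbstractGraphs

section GraphsInAUniverse

/-- A simple graph whose vertex-set is a subset of `U`. This lets several graphs have different,
possibly overlapping, vertex-sets. -/
abbrev GraphIn (U : Type*) := (⊤ : SimpleGraph U).Subgraph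

variable {U : Type*}

/-- `X` is a clique of `G`. -/
def IsCliqueIn (G : GraphIn U) (X : Set U) : Prop := X.Pairwise fun x y => G.Adj x y

/-- `X` is a stable set of `G`. -/
def IsStableIn (G : GraphIn U) (X : Set U) : Prop := X.Pairwise fun x y => ¬ G.Adj x y

/-- `X` is complete to `Y` in `G`. -/
def CompleteTo (G : GraphIn U) (X Y : Set U) : Prop := ∀ x ∈ X, ∀ y ∈ Y, G.Adj x y

/-- `X` is anti-complete to `Y` in `G`. -/
def AnticompleteTo (G : GraphIn U) (X Y : Set U) : Prop := ∀ x ∈ X, ∀ y ∈ Y, ¬ G.Adj x y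

/-- `G` is obtained by substituting `G₁` for the vertex `v` in `G₂`. -/
structure IsSubstitution (G₁ G₂ : GraphIn U) (v : U) (G : GraphIn U) : Prop where
  disjoint_verts : Disjoint G₁.verts G₂.verts
  mem_verts : v ∈ G₂.verts
  verts_eq : G.verts = G₁.verts ∪ (G₂.verts \ {v})
  induce_left : G.induce G₁.verts = G₁
  induce_right : G.induce (G₂.verts \ {v}) = G₂.deleteVerts {v}
  complete_of_adj : ∀ w ∈ G₂.verts \ {v}, G₂.Adj w v → CompleteTo G {w} G₁.verts
  anticomplete_of_not_adj :
    ∀ w ∈ G₂.verts \ {v}, ¬ G₂.Adj w v → AnticompleteTo G {w} G₁.verts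

/-- `(G₁, G₂)` is a composable pair, as witnessed by the sets `A, B, C, L, T` and the
vertices `a, c`. -/
structure IsComposablePair (A B C L T : Set U) (a c : U) (G₁ G₂ : GraphIn U) : Prop where
  pairwise_disjoint : List.Pairwise Disjoint [A, B, C, L, T]
  nonempty_A : A.Nonempty
  nonempty_C : C.Nonempty
  a_ne_c : a ≠ c
  a_notMem : a ∉ A ∪ B ∪ C ∪ L ∪ T
  c_notMem : c ∉ A ∪ B ∪ C ∪ L ∪ T
  verts_left : G₁.verts = A ∪ L ∪ T ∪ {c}
  clique_L : IsCliqueIn G₁ L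
  stable_T : IsStableIn G₁ T
  A_anticomplete_T : AnticompleteTo G₁ A T
  c_complete : CompleteTo G₁ {c} L
  c_anticomplete : AnticompleteTo G₁ {c} (A ∪ T)
  verts_right : G₂.verts = B ∪ C ∪ L ∪ T ∪ {a}
  induce_LT : G₂.induce (L ∪ T) = G₁.induce (L ∪ T)
  T_anticomplete_C : AnticompleteTo G₂ T C
  L_complete : CompleteTo G₂ L (B ∪ C)
  a_complete : CompleteTo G₂ {a} B
  a_anticomplete : AnticompleteTo G₂ {a} (C ∪ L ∪ T)

/-- `G` is the split graph unification of `(G₁, G₂)`, a composable pair as witnessed by the sets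
`A, B, C, L, T` and the vertices `a, c`. -/
structure IsSplitUnification (A B C L T : Set U) (a c : U) (G₁ G₂ G : GraphIn U) : Prop where
  composable : IsComposablePair A B C L T a c G₁ G₂
  verts_eq : G.verts = A ∪ B ∪ C ∪ L ∪ T
  induce_left : G.induce (A ∪ L ∪ T) = G₁.deleteVerts {c}
  induce_right : G.induce (B ∪ C ∪ L ∪ T) = G₂.deleteVerts {a}
  A_complete_B : CompleteTo G A B
  A_anticomplete_C : AnticompleteTo G A C

end GraphsInAUniverse

section Operations

variable {V : Type u}

/-- `G` is, up to isomorphism, obtained by substitution from graphs with property `P`. -/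
def ObtainedBySubstitution (P : (W : Type u) → SimpleGraph W → Prop) (G : SimpleGraph V) : Prop :=
  ∃ (U : Type u) (_ : Finite U) (G₁ G₂ G' : GraphIn U) (v : U),
    IsSubstitution G₁ G₂ v G' ∧ Nonempty (G ≃g G'.coe) ∧ P G₁.verts G₁.coe ∧ P G₂.verts G₂.coe

/-- `G` is, up to isomorphism, obtained by split graph unification from graphs with
property `P`. -/
def ObtainedBySplitUnification (P : (W : Type u) → SimpleGraph W → Prop)
    (G : SimpleGraph V) : Prop :=
  ∃ (U : Type u) (_ : Finite U) (A B C L T : Set U) (a c : U) (G₁ G₂ G' : GraphIn U),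
    IsSplitUnification A B C L T a c G₁ G₂ G' ∧ Nonempty (G ≃g G'.coe) ∧
      P G₁.verts G₁.coe ∧ P G₂.verts G₂.coe

/-- The property of being a `{P₅, complement of P₅}`-free graph with fewer vertices than a graph
with vertex-set `V`. -/
def IsSmallerFree (V : Type u) (W : Type u) (H : SimpleGraph W) : Prop :=
  Nat.card W < Nat.card V ∧ IsP5HouseFree H

end Operations

end P5House

/-! The converse direction is local. Split graphs and the pentagon are checked directly. $P_5$ and
its complement have no proper homogeneous set, so a copy of one in a substitution lies in $G_1$ or
meets it at most once, and then it already occurs in $G_1$ or $G_2$. For a split graph unification,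
a finite check over all labellings of five vertices by $A,B,C,L,T$ (`label_cases`) shows that a copy
can be moved into $G_1$ or $G_2$, with $c$ or $a$ standing in for at most one vertex.

For the forward direction, a proper homogeneous set gives a substitution, so $G$ may be taken prime.
A prime free graph with an induced pentagon is a pentagon (`isPentagon_of_prime`): a maximal
blown-up pentagon is homogeneous, and so are its classes. Otherwise, if $G$ is not split, the
theorem of Földes and Hammer (`isSplit_of_forbidden`) gives an induced $2K_2$ in $G$ or in
$\overline G$.

From a $2K_2$, take a maximal connected set $A$ with at least two vertices that leaves an edge
anti-complete to it. Maximality and freeness make the vertices mixed on $A$ complete to those full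
to $A$ and to the core. If the mixed vertices form a clique, $A$ is a divide of $G$. If not, two
non-adjacent mixed vertices lead to a divide of $\overline G$ (`exists_isDivide_compl`). Contracting
the two sides of a divide exhibits the graph as a split graph unification. -/

namespace P5House

/-! ### Induced copies of the forbidden graphs -/

/-- Adjacency matrix of the five-vertex path. -/
def pathMat (i j : Fin 5) : Bool := i.val + 1 == j.val || j.val + 1 == i.val

/-- Adjacency matrix of the complement of the five-vertex path. -/
def houseMat (i j : Fin 5) : Bool := i != j && !pathMat i j

/-- The map `f` is an induced copy, in the relation `r`, of the graph with adjacency matrix `M`. -/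
def IsCopy {V : Type*} (M : Fin 5 → Fin 5 → Bool) (r : V → V → Prop) (f : Fin 5 → V) : Prop :=
  ∀ i j, r (f i) (f j) ↔ M i j = true

/-- The two forbidden adjacency matrices. -/
def IsForbidden (M : Fin 5 → Fin 5 → Bool) : Prop := M = pathMat ∨ M = houseMat

/-- Distinct rows force every adjacency-preserving map to be injective, so `IsCopy` need not ask for
injectivity. -/
theorem pathMat_separates :
    ∀ i j : Fin 5, (∀ k, pathMat i k = pathMat j k) → i = j := by decide

theorem houseMat_separates :
    ∀ i j : Fin 5, (∀ k, houseMat i k = houseMat j k) → i = j := by decide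

theorem IsForbidden.separates {M : Fin 5 → Fin 5 → Bool} (hM : IsForbidden M) (i j : Fin 5)
    (h : ∀ k, M i k = M j k) : i = j := by
  rcases hM with rfl | rfl
  · exact pathMat_separates i j h
  · exact houseMat_separates i j h

theorem IsCopy.injective {V : Type*} {M : Fin 5 → Fin 5 → Bool} (hM : IsForbidden M)
    {r : V → V → Prop} {f : Fin 5 → V} (hf : IsCopy M r f) : Function.Injective f := by
  intro i j hij
  refine hM.separates i j fun k => ?_
  rw [Bool.eq_iff_iff, ← hf i k, ← hf j k, hij]

theorem isFree_iff {V : Type*} {H : SimpleGraph (Fin 5)} {M : Fin 5 → Fin 5 → Bool}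
    (hM : IsForbidden M) (hH : ∀ i j, H.Adj i j ↔ M i j = true) (G : SimpleGraph V) :
    IsFree H G ↔ ∀ f, ¬ IsCopy M G.Adj f := by
  constructor
  · intro h f hf
    exact h ⟨⟨⟨f, hf.injective hM⟩, fun {i j} => (hf i j).trans (hH i j).symm⟩⟩
  · rintro h ⟨f⟩
    exact h f fun i j => f.map_rel_iff.trans (hH i j)

theorem pathGraph_five_adj (i j : Fin 5) :
    (SimpleGraph.pathGraph 5).Adj i j ↔ pathMat i j = true := by
  simp [SimpleGraph.pathGraph_adj, pathMat]

theorem compl_pathGraph_five_adj (i j : Fin 5) :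
    (SimpleGraph.pathGraph 5)ᶜ.Adj i j ↔ houseMat i j = true := by
  rw [SimpleGraph.compl_adj, pathGraph_five_adj]
  simp [houseMat]

theorem isP5HouseFree_iff {V : Type*} (G : SimpleGraph V) :
    IsP5HouseFree G ↔ ∀ M, IsForbidden M → ∀ f, ¬ IsCopy M G.Adj f := by
  unfold IsP5HouseFree
  rw [isFree_iff (Or.inl rfl) pathGraph_five_adj, isFree_iff (Or.inr rfl) compl_pathGraph_five_adj]
  constructor
  · rintro ⟨h₁, h₂⟩ M (rfl | rfl)
    exacts [h₁, h₂]
  · exact fun h => ⟨h _ (Or.inl rfl), h _ (Or.inr rfl)⟩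

theorem isP5HouseFree_coe_iff {U : Type*} (K : GraphIn U) :
    IsP5HouseFree K.coe ↔
      ∀ M, IsForbidden M → ∀ f : Fin 5 → U, (∀ i, f i ∈ K.verts) → ¬ IsCopy M K.Adj f := by
  rw [isP5HouseFree_iff]
  constructor
  · intro h M hM f hf hc
    exact h M hM (fun i => ⟨f i, hf i⟩) hc
  · intro h M hM f hc
    exact h M hM (fun i => (f i : U)) (fun i => (f i).2) hc

theorem IsP5HouseFree.of_iso {V W : Type*} {G : SimpleGraph V} {H : SimpleGraph W} (e : G ≃g H)
    (h : IsP5HouseFree H) : IsP5HouseFree G := by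
  rw [isP5HouseFree_iff] at h ⊢
  intro M hM f hf
  exact h M hM (e ∘ f) fun i j => e.map_rel_iff.trans (hf i j)

/-- The complement of an adjacency matrix. -/
def complMat (M : Fin 5 → Fin 5 → Bool) (i j : Fin 5) : Bool := i != j && !M i j

theorem IsForbidden.compl {M : Fin 5 → Fin 5 → Bool} (hM : IsForbidden M) :
    IsForbidden (complMat M) := by
  rcases hM with rfl | rfl
  · exact Or.inr rfl
  · left
    funext i j
    revert i j
    decide

theorem IsP5HouseFree.compl {V : Type*} {G : SimpleGraph V} (h : IsP5HouseFree G) :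
    IsP5HouseFree Gᶜ := by
  rw [isP5HouseFree_iff] at h ⊢
  intro M hM f hf
  refine h _ hM.compl f fun i j => ?_
  have hinj := (hf.injective hM).ne_iff (x := i) (y := j)
  have := hf i j
  rw [SimpleGraph.compl_adj, hinj] at this
  have hne : G.Adj (f i) (f j) → i ≠ j := by
    rintro h rfl
    exact G.loopless.irrefl _ h
  simp only [complMat, Bool.and_eq_true, bne_iff_ne, ne_eq, Bool.not_eq_true']
  rw [← Bool.not_eq_true, ← this]
  tauto

theorem isP5HouseFree_compl_iff {V : Type*} {G : SimpleGraph V} :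
    IsP5HouseFree Gᶜ ↔ IsP5HouseFree G :=
  ⟨fun h => by simpa using h.compl, fun h => h.compl⟩

/-- A five-vertex path, listed in order, cannot occur in a free graph. -/
theorem IsP5HouseFree.no_path {V : Type*} {G : SimpleGraph V} (h : IsP5HouseFree G)
    {a b c d e : V} (ab : G.Adj a b) (bc : G.Adj b c) (cd : G.Adj c d) (de : G.Adj d e)
    (ac : ¬ G.Adj a c) (ad : ¬ G.Adj a d) (ae : ¬ G.Adj a e) (bd : ¬ G.Adj b d)
    (be : ¬ G.Adj b e) (ce : ¬ G.Adj c e) : False := by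
  rw [isP5HouseFree_iff] at h
  refine h _ (Or.inl rfl) ![a, b, c, d, e] fun i j => ?_
  fin_cases i <;> fin_cases j <;> simp [pathMat, G.adj_comm, *]

/-- A house, given by a four-cycle `a b c d` and a roof `e` over `a b`, cannot occur in a free
graph. -/
theorem IsP5HouseFree.no_house {V : Type*} {G : SimpleGraph V} (h : IsP5HouseFree G)
    {a b c d e : V} (ab : G.Adj a b) (bc : G.Adj b c) (cd : G.Adj c d) (da : G.Adj d a)
    (ea : G.Adj e a) (eb : G.Adj e b) (ac : ¬ G.Adj a c) (bd : ¬ G.Adj b d)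
    (ec : ¬ G.Adj e c) (ed : ¬ G.Adj e d) : False := by
  rw [isP5HouseFree_iff] at h
  refine h _ (Or.inr rfl) ![a, c, e, d, b] fun i j => ?_
  fin_cases i <;> fin_cases j <;> simp [houseMat, pathMat, G.adj_comm, *] <;>
    first | assumption | (rw [G.adj_comm]; assumption)

/-! ### Labelled forbidden graphs: finite checks -/

/-- The adjacency between vertices of two labels (`A, B, C, L, T` being `0, 1, 2, 3, 4`) that a
split graph unification prescribes, if it prescribes any. -/
def labelAdj : Fin 5 → Fin 5 → Option Bool :=
  ![![none, some true, some false, none, some false],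
    ![some true, none, none, some true, none],
    ![some false, none, none, some true, some false],
    ![none, some true, some true, some true, none],
    ![some false, none, some false, none, some false]]

/-- The labels of `i` and `j` permit the adjacency `b`. -/
def labelOK (x y : Fin 5) (b : Bool) : Bool :=
  match labelAdj x y with
  | none => true
  | some c => b == c

/-- The labels `x` of `i` and `y` of `j` permit the adjacency of `i` and `j`. -/
def pairOK (M : Fin 5 → Fin 5 → Bool) (i : Fin 5) (x : Fin 5) (j : Fin 5) (y : Fin 5) : Bool :=
  labelOK x y (M i j)

/-- The compatibility hypotheses are interleaved with the quantifiers so that the kernel evaluation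
abandons a partial labelling at its first conflict. -/
theorem label_cases_aux (M : Fin 5 → Fin 5 → Bool) (hM : M = pathMat ∨ M = houseMat) :
    ∀ a b : Fin 5, pairOK M 0 a 1 b = true →
    ∀ c : Fin 5, pairOK M 0 a 2 c = true → pairOK M 1 b 2 c = true →
    ∀ d : Fin 5, pairOK M 0 a 3 d = true → pairOK M 1 b 3 d = true → pairOK M 2 c 3 d = true →
    ∀ e : Fin 5, pairOK M 0 a 4 e = true → pairOK M 1 b 4 e = true → pairOK M 2 c 4 e = true →
      pairOK M 3 d 4 e = true →
      (∀ i, ![a, b, c, d, e] i ≠ 0) ∨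
      ((∀ i, ![a, b, c, d, e] i ≠ 1) ∧
        ∀ i j, ![a, b, c, d, e] i = 2 → ![a, b, c, d, e] j = 2 → i = j) ∨
      ∃ i, ![a, b, c, d, e] i = 0 ∧ (∀ j, ![a, b, c, d, e] j = 0 → j = i) ∧
        ∀ j, ![a, b, c, d, e] j = 3 → M i j = false := by
  rcases hM with rfl | rfl <;> decide +kernel

theorem label_cases₂_aux (M : Fin 5 → Fin 5 → Bool) (hM : M = pathMat ∨ M = houseMat) :
    ∀ a b : Fin 5, pairOK M 0 a 1 b = true →
    ∀ c : Fin 5, pairOK M 0 a 2 c = true → pairOK M 1 b 2 c = true →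
    ∀ d : Fin 5, pairOK M 0 a 3 d = true → pairOK M 1 b 3 d = true → pairOK M 2 c 3 d = true →
    ∀ e : Fin 5, pairOK M 0 a 4 e = true → pairOK M 1 b 4 e = true → pairOK M 2 c 4 e = true →
      pairOK M 3 d 4 e = true →
      ∀ i, ![a, b, c, d, e] i = 0 → (∀ j, ![a, b, c, d, e] j = 0 → j = i) →
        (∀ j, ![a, b, c, d, e] j = 3 → M i j = false) →
        ∀ j k, ![a, b, c, d, e] j = 3 → ![a, b, c, d, e] k = 3 → j = k := by
  rcases hM with rfl | rfl <;> decide +kernel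
-- The alternatives say where a copy can be moved: into $G_2$ as it stands; into $G_1$ with $c$
-- replacing its only $C$-vertex; into $G_2$ with $a$ replacing its only $A$-vertex, which must then
-- miss the $L$-vertices of the copy, as $a$ does.
theorem label_cases {M : Fin 5 → Fin 5 → Bool} (hM : IsForbidden M) (l : Fin 5 → Fin 5)
    (hl : ∀ i j, i ≠ j → labelOK (l i) (l j) (M i j) = true) :
    (∀ i, l i ≠ 0) ∨
      ((∀ i, l i ≠ 1) ∧ ∀ i j, l i = 2 → l j = 2 → i = j) ∨
      ∃ i, l i = 0 ∧ (∀ j, l j = 0 → j = i) ∧ ∀ j, l j = 3 → M i j = false := by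
  have key := label_cases_aux M hM (l 0) (l 1) (hl _ _ (by decide)) (l 2) (hl _ _ (by decide))
    (hl _ _ (by decide)) (l 3) (hl _ _ (by decide)) (hl _ _ (by decide)) (hl _ _ (by decide))
    (l 4) (hl _ _ (by decide)) (hl _ _ (by decide)) (hl _ _ (by decide)) (hl _ _ (by decide))
  have e : ![l 0, l 1, l 2, l 3, l 4] = l := by
    funext i
    fin_cases i <;> rfl
  rwa [e] at key

/-- Needed for the converse passage from $G_2$ to $G$: when $a$ is to be replaced by a vertex of
$A$, only one vertex of $L$ has to be avoided. -/
theorem label_unique_clique {M : Fin 5 → Fin 5 → Bool} (hM : IsForbidden M) (l : Fin 5 → Fin 5)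
    (hl : ∀ i j, i ≠ j → labelOK (l i) (l j) (M i j) = true) (i : Fin 5) (hi : l i = 0)
    (hu : ∀ j, l j = 0 → j = i) (hL : ∀ j, l j = 3 → M i j = false) (j k : Fin 5) (hj : l j = 3)
    (hk : l k = 3) : j = k := by
  have key := label_cases₂_aux M hM (l 0) (l 1) (hl _ _ (by decide)) (l 2) (hl _ _ (by decide))
    (hl _ _ (by decide)) (l 3) (hl _ _ (by decide)) (hl _ _ (by decide)) (hl _ _ (by decide))
    (l 4) (hl _ _ (by decide)) (hl _ _ (by decide)) (hl _ _ (by decide)) (hl _ _ (by decide))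
  have e : ![l 0, l 1, l 2, l 3, l 4] = l := by
    funext i
    fin_cases i <;> rfl
  rw [e] at key
  exact key i hi hu hL j k hj hk

/-- Primality of the two forbidden graphs, with candidate homogeneous sets coded as Boolean
functions. -/
theorem forbidden_module (M : Fin 5 → Fin 5 → Bool) (hM : IsForbidden M) :
    ∀ S : Fin 5 → Bool, (∀ i, S i = true) ∨ (∀ i j, S i = true → S j = true → i = j) ∨
      ∃ k, S k = false ∧ ∃ i j, S i = true ∧ S j = true ∧ M k i = true ∧ M k j = false := by
  rcases hM with rfl | rfl <;> decide +kernel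

/-! ### The operations and the basic classes preserve freeness -/

theorem adj_iff_of_induce_eq_deleteVerts {U : Type*} {K K' : GraphIn U} {S : Set U} {c : U}
    (h : K.induce S = K'.deleteVerts {c}) {x y : U} (hx : x ∈ S) (hy : y ∈ S) :
    K.Adj x y ↔ K'.Adj x y := by
  have hv : ∀ z ∈ S, z ∈ K'.verts \ {c} := fun z hz => by
    have := congrArg SimpleGraph.Subgraph.verts h
    simp only [SimpleGraph.Subgraph.induce_verts] at this
    rwa [← this]
  have e : (K.induce S).Adj x y ↔ (K'.deleteVerts {c}).Adj x y := by rw [h]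
  have hx' := hv x hx
  have hy' := hv y hy
  simp only [SimpleGraph.Subgraph.induce_adj] at e
  simp only [Set.mem_sdiff] at hx' hy'
  tauto

theorem IsSubstitution.free {U : Type*} {G₁ G₂ G : GraphIn U} {v : U}
    (h : IsSubstitution G₁ G₂ v G) (h₁ : IsP5HouseFree G₁.coe) (h₂ : IsP5HouseFree G₂.coe) :
    IsP5HouseFree G.coe := by
  classical
  rw [isP5HouseFree_coe_iff] at *
  intro M hM f hf hc
  have hadj₁ : ∀ x ∈ G₁.verts, ∀ y ∈ G₁.verts, (G.Adj x y ↔ G₁.Adj x y) := fun x hx y hy => by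
    have e : (G.induce G₁.verts).Adj x y ↔ G₁.Adj x y := by rw [h.induce_left]
    rw [← e]
    simp [hx, hy]
  have hadj₂ : ∀ x ∈ G₂.verts \ {v}, ∀ y ∈ G₂.verts \ {v}, (G.Adj x y ↔ G₂.Adj x y) :=
    fun x hx y hy => adj_iff_of_induce_eq_deleteVerts h.induce_right hx hy
  have hmem : ∀ i, f i ∉ G₁.verts → f i ∈ G₂.verts \ {v} := fun i hi => by
    have := hf i
    rw [h.verts_eq] at this
    exact this.resolve_left hi
  have hout : ∀ w ∈ G₂.verts \ {v}, ∀ x ∈ G₁.verts, (G.Adj w x ↔ G₂.Adj w v) := fun w hw x hx => by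
    by_cases hwv : G₂.Adj w v
    · exact iff_of_true (h.complete_of_adj w hw hwv w rfl x hx) hwv
    · exact iff_of_false (h.anticomplete_of_not_adj w hw hwv w rfl x hx) hwv
  rcases forbidden_module M hM fun i => decide (f i ∈ G₁.verts) with hS | hS | ⟨k, hk, i, j, hS⟩
  · simp only [decide_eq_true_eq] at hS
    exact h₁ M hM f hS fun i j => (hadj₁ _ (hS i) _ (hS j)).symm.trans (hc i j)
  · simp only [decide_eq_true_eq] at hS
    -- The copy has at most one vertex in $G_1$, and $v$ sees the rest of the copy exactly as that
    -- vertex does.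
    refine h₂ M hM (fun i => if f i ∈ G₁.verts then v else f i) (fun i => ?_) fun i j => ?_
    · split_ifs with hi
      exacts [h.mem_verts, (hmem i hi).1]
    · rw [← hc i j]
      dsimp only
      split_ifs with hi hj hj
      · obtain rfl := hS i j hi hj
        exact iff_of_false (fun h => h.ne rfl) (fun h => h.ne rfl)
      · rw [G₂.adj_comm, G.adj_comm]
        exact (hout _ (hmem j hj) _ hi).symm
      · exact (hout _ (hmem i hi) _ hj).symm
      · exact (hadj₂ _ (hmem i hi) _ (hmem j hj)).symm
  · simp only [decide_eq_true_eq, decide_eq_false_iff_not] at hk hS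
    obtain ⟨hi, hj, hki, hkj⟩ := hS
    have a := (hout _ (hmem k hk) _ hi).1 ((hc k i).2 hki)
    have b := (hc k j).1 ((hout _ (hmem k hk) _ hj).2 a)
    simp [hkj] at b

/-- The relation `r` has the adjacencies that `labelAdj` prescribes between the five classes. -/
def Respects {U : Type*} (r : U → U → Prop) (S : Fin 5 → Set U) : Prop :=
  ∀ k m b, labelAdj k m = some b → ∀ x ∈ S k, ∀ y ∈ S m, x ≠ y → (r x y ↔ b = true)

theorem Respects.of_classes {U : Type*} {r : U → U → Prop} (hr : ∀ x y, r x y → r y x)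
    {A B C L T : Set U} (hAB : ∀ x ∈ A, ∀ y ∈ B, r x y) (hAC : ∀ x ∈ A, ∀ y ∈ C, ¬ r x y)
    (hAT : ∀ x ∈ A, ∀ y ∈ T, ¬ r x y) (hLB : ∀ x ∈ L, ∀ y ∈ B, r x y)
    (hLC : ∀ x ∈ L, ∀ y ∈ C, r x y) (hTC : ∀ x ∈ T, ∀ y ∈ C, ¬ r x y)
    (hL : ∀ x ∈ L, ∀ y ∈ L, x ≠ y → r x y) (hT : ∀ x ∈ T, ∀ y ∈ T, x ≠ y → ¬ r x y) :
    Respects r ![A, B, C, L, T] := by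
  intro k m b h x hx y hy hxy
  have hr' : r x y ↔ r y x := ⟨hr x y, hr y x⟩
  fin_cases k <;> fin_cases m <;> simp [labelAdj] at h hx hy <;> subst h <;> simp <;>
    first
    | exact hAB x hx y hy
    | exact hAC x hx y hy
    | exact hAT x hx y hy
    | exact hLB x hx y hy
    | exact hLC x hx y hy
    | exact hTC x hx y hy
    | exact hL x hx y hy hxy
    | exact hT x hx y hy hxy
    | (rw [hr']; first
        | exact hAB y hy x hx
        | exact hAC y hy x hx
        | exact hAT y hy x hx
        | exact hLB y hy x hx
        | exact hLC y hy x hx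
        | exact hTC y hy x hx)

theorem Respects.labelOK {U : Type*} {r : U → U → Prop} {S : Fin 5 → Set U} (hS : Respects r S)
    {M : Fin 5 → Fin 5 → Bool} (hM : IsForbidden M) {f : Fin 5 → U} (hf : IsCopy M r f)
    {l : Fin 5 → Fin 5} (hl : ∀ i, f i ∈ S (l i)) (i j : Fin 5) (hij : i ≠ j) :
    labelOK (l i) (l j) (M i j) = true := by
  unfold P5House.labelOK
  split
  · rfl
  · next b hb =>
    have := hS _ _ b hb _ (hl i) _ (hl j) fun e => hij (hf.injective hM e)
    rw [hf i j] at this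
    rw [beq_iff_eq, Bool.eq_iff_iff]
    exact this

theorem exists_label {U : Type*} {A B C L T : Set U} {f : Fin 5 → U}
    (hf : ∀ i, f i ∈ A ∪ B ∪ C ∪ L ∪ T) :
    ∃ l : Fin 5 → Fin 5, ∀ i, f i ∈ (![A, B, C, L, T] : Fin 5 → Set U) (l i) := by
  have : ∀ i, ∃ k, f i ∈ (![A, B, C, L, T] : Fin 5 → Set U) k := fun i => by
    rcases hf i with (((h | h) | h) | h) | h
    exacts [⟨0, h⟩, ⟨1, h⟩, ⟨2, h⟩, ⟨3, h⟩, ⟨4, h⟩]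
  choose l hl using this
  exact ⟨l, hl⟩

theorem mem_of_label_ne_zero {U : Type*} {A B C L T : Set U} {x : U} {k : Fin 5}
    (hx : x ∈ (![A, B, C, L, T] : Fin 5 → Set U) k) (hk : k ≠ 0) : x ∈ B ∪ C ∪ L ∪ T := by
  fin_cases k <;> simp_all

theorem mem_of_label_ne_one_two {U : Type*} {A B C L T : Set U} {x : U} {k : Fin 5}
    (hx : x ∈ (![A, B, C, L, T] : Fin 5 → Set U) k) (hk : k ≠ 1) (hk' : k ≠ 2) :
    x ∈ A ∪ L ∪ T := by
  fin_cases k <;> simp_all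

theorem IsSplitUnification.free {U : Type*} {A B C L T : Set U} {a c : U} {G₁ G₂ G : GraphIn U}
    (h : IsSplitUnification A B C L T a c G₁ G₂ G) (h₁ : IsP5HouseFree G₁.coe)
    (h₂ : IsP5HouseFree G₂.coe) : IsP5HouseFree G.coe := by
  classical
  rw [isP5HouseFree_coe_iff] at *
  intro M hM f hf hc
  obtain ⟨hcomp, hverts, hl, hr, hAB, hAC⟩ := h
  obtain ⟨-, -, -, -, -, -, hv₁, hLc, hTs, hAT, hcL, hcAT, hv₂, -, hTC, hLBC, haB, haCLT⟩ := hcomp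
  have adjl : ∀ x ∈ A ∪ L ∪ T, ∀ y ∈ A ∪ L ∪ T, (G.Adj x y ↔ G₁.Adj x y) := fun x hx y hy =>
    adj_iff_of_induce_eq_deleteVerts hl hx hy
  have adjr : ∀ x ∈ B ∪ C ∪ L ∪ T, ∀ y ∈ B ∪ C ∪ L ∪ T, (G.Adj x y ↔ G₂.Adj x y) :=
    fun x hx y hy => adj_iff_of_induce_eq_deleteVerts hr hx hy
  have hAT' : ∀ x ∈ A, ∀ y ∈ T, ¬ G.Adj x y := fun x hx y hy => by
    rw [adjl x (by simp [hx]) y (by simp [hy])]; exact hAT x hx y hy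
  have hLB' : ∀ x ∈ L, ∀ y ∈ B, G.Adj x y := fun x hx y hy => by
    rw [adjr x (by simp [hx]) y (by simp [hy])]; exact hLBC x hx y (by simp [hy])
  have hLC' : ∀ x ∈ L, ∀ y ∈ C, G.Adj x y := fun x hx y hy => by
    rw [adjr x (by simp [hx]) y (by simp [hy])]; exact hLBC x hx y (by simp [hy])
  have hTC' : ∀ x ∈ T, ∀ y ∈ C, ¬ G.Adj x y := fun x hx y hy => by
    rw [adjr x (by simp [hx]) y (by simp [hy])]; exact hTC x hx y hy
  have hS : Respects G.Adj ![A, B, C, L, T] := by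
    refine Respects.of_classes (fun x y h => h.symm) hAB hAC hAT' hLB' hLC' hTC'
      (fun x hx y hy hxy => ?_) fun x hx y hy hxy => ?_
    · rw [adjl x (by simp [hx]) y (by simp [hy])]; exact hLc hx hy hxy
    · rw [adjl x (by simp [hx]) y (by simp [hy])]; exact hTs hx hy hxy
  obtain ⟨l, hmem⟩ := exists_label fun i => hverts ▸ hf i
  rcases label_cases hM l (hS.labelOK hM hc hmem) with h | ⟨h, h'⟩ | ⟨i₀, h0, h, h'⟩
  · have hm : ∀ i, f i ∈ B ∪ C ∪ L ∪ T := fun i => mem_of_label_ne_zero (hmem i) (h i)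
    refine h₂ M hM f (fun i => ?_) fun i j => ?_
    · rw [hv₂]; exact Or.inl (hm i)
    · rw [← hc i j, adjr _ (hm i) _ (hm j)]
  · have hm : ∀ i, l i ≠ 2 → f i ∈ A ∪ L ∪ T := fun i hi =>
      mem_of_label_ne_one_two (hmem i) (h i) hi
    -- With no $B$-vertex in the copy, a vertex of $C$ is complete to $L$ and anti-complete to
    -- $A\cup T$, just like $c$.
    have hcadj : ∀ i j, l i = 2 → l j ≠ 2 → (G₁.Adj c (f j) ↔ G.Adj (f i) (f j)) := by
      intro i j hi hj
      have hi' : f i ∈ C := by simpa [hi] using hmem i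
      rcases hm j hj with (hj' | hj') | hj'
      · exact iff_of_false (hcAT c rfl _ (Or.inl hj')) fun h => hAC _ hj' _ hi' h.symm
      · exact iff_of_true (hcL c rfl _ hj') (hLC' _ hj' _ hi').symm
      · exact iff_of_false (hcAT c rfl _ (Or.inr hj')) fun h => hTC' _ hj' _ hi' h.symm
    refine h₁ M hM (fun i => if l i = 2 then c else f i) (fun i => ?_) fun i j => ?_
    · rw [hv₁]
      by_cases hi : l i = 2
      · simp [hi]
      · simpa only [if_neg hi] using Set.mem_union_left _ (hm i hi)
    · rw [← hc i j]
      by_cases hi : l i = 2 <;> by_cases hj : l j = 2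
      · obtain rfl := h' i j hi hj
        exact iff_of_false (fun h => h.ne rfl) (fun h => h.ne rfl)
      · simpa only [if_pos hi, if_neg hj] using hcadj i j hi hj
      · simpa only [if_pos hj, if_neg hi, G₁.adj_comm _ c, G.adj_comm (f i)] using hcadj j i hj hi
      · simpa only [if_neg hj, if_neg hi] using (adjl _ (hm i hi) _ (hm j hj)).symm
  · have hm : ∀ i, i ≠ i₀ → f i ∈ B ∪ C ∪ L ∪ T := fun i hi =>
      mem_of_label_ne_zero (hmem i) fun e => hi (h i e)
    have h0' : f i₀ ∈ A := by simpa [h0] using hmem i₀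
    have hladj : ∀ j, l j = 3 → ¬ G.Adj (f i₀) (f j) := fun j hj => by
      rw [hc i₀ j, h' j hj]; simp
    have haadj : ∀ j, j ≠ i₀ → (G₂.Adj a (f j) ↔ G.Adj (f i₀) (f j)) := by
      intro j hj
      have hmj := hmem j
      have hk : l j = 0 ∨ l j = 1 ∨ l j = 2 ∨ l j = 3 ∨ l j = 4 := by
        generalize l j = k
        revert k
        decide
      rcases hk with hk | hk | hk | hk | hk <;> rw [hk] at hmj
      · exact absurd (h j hk) hj
      · exact iff_of_true (haB a rfl _ hmj) (hAB _ h0' _ hmj)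
      · exact iff_of_false (haCLT a rfl _ (Or.inl (Or.inl hmj))) (hAC _ h0' _ hmj)
      · exact iff_of_false (haCLT a rfl _ (Or.inl (Or.inr hmj))) (hladj j hk)
      · exact iff_of_false (haCLT a rfl _ (Or.inr hmj)) (hAT' _ h0' _ hmj)
    refine h₂ M hM (fun i => if i = i₀ then a else f i) (fun i => ?_) fun i j => ?_
    · rw [hv₂]
      by_cases hi : i = i₀
      · simp [hi]
      · simpa only [if_neg hi] using Set.mem_union_left _ (hm i hi)
    · rw [← hc i j]
      by_cases hi : i = i₀ <;> by_cases hj : j = i₀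
      · rw [hi, hj]
        exact iff_of_false (fun h => h.ne rfl) (fun h => h.ne rfl)
      · subst hi
        simpa only [if_true, if_neg hj] using haadj j hj
      · subst hj
        simpa only [if_true, if_neg hi, G₂.adj_comm _ a, G.adj_comm (f i)] using haadj i hi
      · simpa only [if_neg hj, if_neg hi] using (adjr _ (hm i hi) _ (hm j hj)).symm

theorem IsSplit.compl {V : Type*} {G : SimpleGraph V} (h : IsSplit G) : IsSplit Gᶜ := by
  obtain ⟨K, S, hd, hu, hK, hS⟩ := h
  refine ⟨S, K, hd.symm, by rw [Set.union_comm, hu], ?_, ?_⟩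
  · rwa [SimpleGraph.isClique_compl]
  · rwa [SimpleGraph.isIndepSet_compl]

/-- The end edges of $P_5$ form a $2K_2$. Each must meet the clique, yet no edge joins them. -/
theorem IsSplit.not_isCopy_pathMat {V : Type*} {G : SimpleGraph V} (h : IsSplit G)
    (f : Fin 5 → V) : ¬ IsCopy pathMat G.Adj f := by
  obtain ⟨K, S, -, hu, hK, hS⟩ := h
  intro hf
  have hinj := hf.injective (Or.inl rfl)
  have hmem : ∀ i, f i ∈ K ∨ f i ∈ S := fun i => by
    have := Set.mem_univ (f i)
    rwa [← hu] at this
  have hpos : ∀ i j, i ≠ j → f i ∈ K → f j ∈ K → pathMat i j = true := fun i j hij hi hj =>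
    (hf i j).1 (hK hi hj (hinj.ne hij))
  have hneg : ∀ i j, i ≠ j → f i ∈ S → f j ∈ S → pathMat i j ≠ true := fun i j hij hi hj =>
    (hf i j).not.1 (hS hi hj (hinj.ne hij))
  have key : ∀ i j, i ≠ j → pathMat i j = true → f i ∈ K ∨ f j ∈ K := fun i j hij h => by
    by_contra! hc
    exact hneg i j hij ((hmem i).resolve_left hc.1) ((hmem j).resolve_left hc.2) h
  rcases key 0 1 (by decide) (by decide) with h | h <;>
    rcases key 3 4 (by decide) (by decide) with h' | h' <;>
    exact absurd (hpos _ _ (by decide) h h') (by decide)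

theorem IsSplit.free {V : Type*} {G : SimpleGraph V} (h : IsSplit G) : IsP5HouseFree G := by
  rw [isP5HouseFree_iff]
  rintro M (rfl | rfl) f hf
  · exact h.not_isCopy_pathMat f hf
  · refine h.compl.not_isCopy_pathMat f fun i j => ?_
    have hinj := (hf.injective (Or.inr rfl)).ne_iff (x := i) (y := j)
    rw [SimpleGraph.compl_adj, hinj, hf i j]
    clear hinj
    revert i j
    decide

/-- A copy would use all five vertices, but every vertex of the pentagon has two neighbours and two
non-neighbours, whereas vertex `0` has one neighbour in the path and one non-neighbour in its
complement. -/
theorem IsPentagon.free {V : Type*} {G : SimpleGraph V} (h : IsPentagon G) : IsP5HouseFree G := by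
  obtain ⟨e⟩ := h
  refine IsP5HouseFree.of_iso e ?_
  rw [isP5HouseFree_iff]
  intro M hM f hf
  have hsurj := Finite.surjective_of_injective (hf.injective hM)
  obtain ⟨i, hi⟩ : ∃ i, f i = f 0 + 1 := hsurj _
  obtain ⟨j, hj⟩ : ∃ j, f j = f 0 - 1 := hsurj _
  obtain ⟨k, hk⟩ : ∃ k, f k = f 0 + 2 := hsurj _
  obtain ⟨m, hm⟩ : ∃ m, f m = f 0 - 2 := hsurj _
  have h1 := hf 0 i
  have h2 := hf 0 j
  have h3 := hf 0 k
  have h4 := hf 0 m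
  have hij : i ≠ j := by
    rintro rfl
    exact absurd (hi.symm.trans hj) (by generalize f 0 = x; revert x; decide)
  have hkm : k ≠ m := by
    rintro rfl
    exact absurd (hk.symm.trans hm) (by generalize f 0 = x; revert x; decide)
  have hk0 : 0 ≠ k := by
    rintro rfl
    exact absurd hk (by generalize f 0 = x; revert x; decide)
  have hm0 : 0 ≠ m := by
    rintro rfl
    exact absurd hm (by generalize f 0 = x; revert x; decide)
  rw [hi] at h1
  rw [hj] at h2
  rw [hk] at h3
  rw [hm] at h4
  have c1 : ∀ x : Fin 5, (SimpleGraph.cycleGraph 5).Adj x (x + 1) := by decide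
  have c2 : ∀ x : Fin 5, (SimpleGraph.cycleGraph 5).Adj x (x - 1) := by decide
  have c3 : ∀ x : Fin 5, ¬ (SimpleGraph.cycleGraph 5).Adj x (x + 2) := by decide
  have c4 : ∀ x : Fin 5, ¬ (SimpleGraph.cycleGraph 5).Adj x (x - 2) := by decide
  have h1' := h1.1 (c1 _)
  have h2' := h2.1 (c2 _)
  have h3' := h3.not.1 (c3 _)
  have h4' := h4.not.1 (c4 _)
  clear h1 h2 h3 h4 hi hj hk hm
  rcases hM with rfl | rfl
  · revert i j
    clear hkm hk0 hm0 h3' h4'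
    decide
  · revert k m
    clear hij h1' h2'
    decide

theorem ObtainedBySubstitution.free {V : Type*} {G : SimpleGraph V}
    (h : ObtainedBySubstitution (IsSmallerFree V) G) : IsP5HouseFree G := by
  obtain ⟨U, _, G₁, G₂, G', v, hs, ⟨e⟩, h₁, h₂⟩ := h
  exact IsP5HouseFree.of_iso e (hs.free h₁.2 h₂.2)

theorem ObtainedBySplitUnification.free {V : Type*} {G : SimpleGraph V}
    (h : ObtainedBySplitUnification (IsSmallerFree V) G) : IsP5HouseFree G := by
  obtain ⟨U, _, A, B, C, L, T, a, c, G₁, G₂, G', hs, ⟨e⟩, h₁, h₂⟩ := h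
  exact IsP5HouseFree.of_iso e (hs.free h₁.2 h₂.2)

/-! ### From a split graph divide to a split graph unification -/

section Divide

variable {V : Type*}

/-- `v` lies outside `A` and has no neighbour in `A`. -/
def AntiTo (G : SimpleGraph V) (A : Set V) (v : V) : Prop := v ∉ A ∧ ∀ a ∈ A, ¬ G.Adj v a

/-- `v` lies outside `A` and is adjacent to every vertex of `A`. -/
def FullTo (G : SimpleGraph V) (A : Set V) (v : V) : Prop := v ∉ A ∧ ∀ a ∈ A, G.Adj v a

/-- `v` lies outside `A` and has both a neighbour and a non-neighbour in `A`. -/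
def MixedOn (G : SimpleGraph V) (A : Set V) (v : V) : Prop :=
  v ∉ A ∧ (∃ a ∈ A, G.Adj v a) ∧ ∃ a ∈ A, ¬ G.Adj v a

/-- `v` is a non-isolated vertex of the subgraph induced by the vertices anti-complete to `A`. -/
def InCore (G : SimpleGraph V) (A : Set V) (v : V) : Prop :=
  AntiTo G A v ∧ ∃ w, AntiTo G A w ∧ G.Adj v w

/-- The set `A` determines a split graph divide of `G`. -/
structure IsDivide (G : SimpleGraph V) (A : Set V) : Prop where
  nontrivial : A.Nontrivial
  exists_core : ∃ c, InCore G A c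
  mixed_clique : ∀ x y, MixedOn G A x → MixedOn G A y → x ≠ y → G.Adj x y
  mixed_core : ∀ x c, MixedOn G A x → InCore G A c → G.Adj x c
  mixed_full : ∀ x b, MixedOn G A x → FullTo G A b → G.Adj x b

theorem mem_or_full_or_core_or_mixed_or_anti (G : SimpleGraph V) (A : Set V) (v : V) :
    v ∈ A ∨ FullTo G A v ∨ InCore G A v ∨ MixedOn G A v ∨ (AntiTo G A v ∧ ¬ InCore G A v) := by
  by_cases h : v ∈ A
  · exact Or.inl h
  by_cases h₁ : ∃ a ∈ A, G.Adj v a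
  · by_cases h₂ : ∃ a ∈ A, ¬ G.Adj v a
    · exact Or.inr (Or.inr (Or.inr (Or.inl ⟨h, h₁, h₂⟩)))
    · push Not at h₂
      exact Or.inr (Or.inl ⟨h, h₂⟩)
  · push Not at h₁
    have : AntiTo G A v := ⟨h, h₁⟩
    tauto

theorem MixedOn.not_full {G : SimpleGraph V} {A : Set V} {v : V} (h : MixedOn G A v) :
    ¬ FullTo G A v := by
  obtain ⟨-, -, a, ha, hva⟩ := h
  exact fun h => hva (h.2 a ha)

theorem MixedOn.not_anti {G : SimpleGraph V} {A : Set V} {v : V} (h : MixedOn G A v) :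
    ¬ AntiTo G A v := by
  obtain ⟨-, ⟨a, ha, hva⟩, -⟩ := h
  exact fun h => h.2 a ha hva

theorem FullTo.not_anti {G : SimpleGraph V} {A : Set V} {v : V} (hA : A.Nonempty)
    (h : FullTo G A v) : ¬ AntiTo G A v := by
  obtain ⟨a, ha⟩ := hA
  exact fun h' => h'.2 a ha (h.2 a ha)

/-- Adjacency in the graph obtained from `G` by adding a vertex `inr true` complete to the vertices
full to `A`, and a vertex `inr false` complete to the vertices mixed on `A`. -/
def extAdj (G : SimpleGraph V) (A : Set V) : V ⊕ Bool → V ⊕ Bool → Prop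
  | Sum.inl x, Sum.inl y => G.Adj x y
  | Sum.inl x, Sum.inr true => FullTo G A x
  | Sum.inr true, Sum.inl x => FullTo G A x
  | Sum.inl x, Sum.inr false => MixedOn G A x
  | Sum.inr false, Sum.inl x => MixedOn G A x
  | Sum.inr _, Sum.inr _ => False

theorem extAdj_symm (G : SimpleGraph V) (A : Set V) (x y : V ⊕ Bool) (h : extAdj G A x y) :
    extAdj G A y x := by
  rcases x with x | (_ | _) <;> rcases y with y | (_ | _) <;> simp_all [extAdj, G.adj_comm]

theorem extAdj_ne (G : SimpleGraph V) (A : Set V) (x y : V ⊕ Bool) (h : extAdj G A x y) :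
    x ≠ y := by
  rintro rfl
  rcases x with x | (_ | _) <;> simp_all [extAdj]

/-- The graph with adjacency `extAdj`. -/
def extGraph (G : SimpleGraph V) (A : Set V) : GraphIn (V ⊕ Bool) where
  verts := Set.univ
  Adj := extAdj G A
  adj_sub := fun h => extAdj_ne G A _ _ h
  edge_vert := fun _ => Set.mem_univ _
  symm := ⟨fun x y h => extAdj_symm G A x y h⟩

theorem induce_induce_of_subset {U : Type*} (K : GraphIn U) {S S' : Set U} (h : S ⊆ S') :
    (K.induce S').induce S = K.induce S := by
  ext x y
  · rfl
  · simp only [SimpleGraph.Subgraph.induce_adj]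
    have := @h x
    have := @h y
    tauto

theorem deleteVerts_induce_union_singleton {U : Type*} (K : GraphIn U) {S : Set U} {c : U}
    (h : c ∉ S) : (K.induce (S ∪ {c})).deleteVerts {c} = K.induce S := by
  have e : (S ∪ {c}) \ {c} = S := by
    ext x
    simp only [Set.mem_sdiff, Set.mem_union, Set.mem_singleton_iff]
    constructor
    · tauto
    · rintro hx
      exact ⟨Or.inl hx, fun e => h (e ▸ hx)⟩
  unfold SimpleGraph.Subgraph.deleteVerts
  rw [SimpleGraph.Subgraph.induce_verts, e,
    induce_induce_of_subset K Set.subset_union_left]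

/-- Two vertices are left out and only one is added. -/
theorem card_image_inl_union_lt [Finite V] (X : Set V) (s : Bool) {p q : V} (hpq : p ≠ q)
    (hp : p ∉ X) (hq : q ∉ X) :
    Nat.card ↥((Sum.inl '' X ∪ {Sum.inr s} : Set (V ⊕ Bool))) < Nat.card V := by
  rw [Nat.card_coe_set_eq]
  have h1 : (Sum.inl '' X ∪ {Sum.inr s} : Set (V ⊕ Bool)).ncard ≤ X.ncard + 1 := by
    refine (Set.ncard_union_le _ _).trans ?_
    rw [Set.ncard_singleton, Set.ncard_image_of_injective _ Sum.inl_injective]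
  have h2 : (X ∪ {p, q}).ncard = X.ncard + 2 := by
    rw [Set.ncard_union_eq, Set.ncard_pair hpq]
    rw [Set.disjoint_right]
    rintro x (rfl | rfl)
    exacts [hp, hq]
  have h3 : (X ∪ {p, q}).ncard ≤ Nat.card V := by
    rw [← Set.ncard_univ]
    exact Set.ncard_le_ncard (Set.subset_univ _)
  omega

/-- A core vertex of $G$ is complete to the mixed vertices and anti-complete to $A$ and $T$, so it
can play the new vertex: the graph is an induced subgraph of $G$ up to isomorphism. -/
theorem IsDivide.free_left {G : SimpleGraph V} {A : Set V} (h : IsDivide G A)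
    (hG : IsP5HouseFree G) :
    IsP5HouseFree ((extGraph G A).induce (Sum.inl '' (A ∪ {x | MixedOn G A x} ∪
      {x | AntiTo G A x ∧ ¬ InCore G A x}) ∪ {Sum.inr false})).coe := by
  obtain ⟨c, hc⟩ := h.exists_core
  rw [isP5HouseFree_coe_iff]
  rw [isP5HouseFree_iff] at hG
  intro M hM f hf hcopy
  refine hG M hM (fun i => Sum.elim id (fun _ => c) (f i)) fun i j => ?_
  rw [← hcopy i j, SimpleGraph.Subgraph.induce_adj]
  have hi := hf i
  have hj := hf j
  rw [SimpleGraph.Subgraph.induce_verts] at hi hj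
  simp only [hi, hj, true_and]
  have key : ∀ x ∈ A ∪ {x | MixedOn G A x} ∪ {x | AntiTo G A x ∧ ¬ InCore G A x},
      (G.Adj c x ↔ MixedOn G A x) := by
    rintro x ((hx | hx) | hx)
    · exact iff_of_false (hc.1.2 x hx) fun h => h.1 hx
    · exact iff_of_true (h.mixed_core x c hx hc).symm hx
    · exact iff_of_false (fun h => hx.2 ⟨hx.1, c, hc.1, h.symm⟩) fun h => h.not_anti hx.1
  rcases hi with ⟨x, hx, e⟩ | e <;> rcases hj with ⟨y, hy, e'⟩ | e'
  · rw [← e, ← e']; rfl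
  · rw [← e, e', G.adj_comm]
    exact key x hx
  · rw [← e', e]
    exact key y hy
  · rw [e, e']
    exact iff_of_false (fun h => h.ne rfl) id

/-- A single vertex of $A$ need not miss all mixed vertices, so the graph need not embed in $G$. But
a forbidden copy through the new vertex contains at most one mixed vertex, and that vertex has a
non-neighbour in $A$ which can replace the new one. -/
theorem IsDivide.free_right {G : SimpleGraph V} {A : Set V} (h : IsDivide G A)
    (hG : IsP5HouseFree G) :
    IsP5HouseFree ((extGraph G A).induce (Sum.inl '' ({x | FullTo G A x} ∪ {x | InCore G A x} ∪
      {x | MixedOn G A x} ∪ {x | AntiTo G A x ∧ ¬ InCore G A x}) ∪ {Sum.inr true})).coe := by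
  rw [isP5HouseFree_coe_iff]
  rw [isP5HouseFree_iff] at hG
  intro M hM f hf hcopy
  simp only [SimpleGraph.Subgraph.induce_verts] at hf
  have hA := h.nontrivial.nonempty
  have hcopy' : IsCopy M (extAdj G A) f := fun i j => by
    rw [← hcopy i j, SimpleGraph.Subgraph.induce_adj]
    simp only [hf i, hf j, true_and]
    rfl
  -- The representative $a$ depends on the copy `f`: it only has to miss the mixed vertices that `f`
  -- uses.
  obtain ⟨a, ha, hna⟩ : ∃ a ∈ A, ∀ i, f i = Sum.inr true →
      ∀ j x, f j = Sum.inl x → MixedOn G A x → ¬ G.Adj x a := by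
    by_cases hex : ∃ i, f i = Sum.inr true
    swap
    · obtain ⟨a, ha⟩ := hA
      exact ⟨a, ha, fun i hi => absurd ⟨i, hi⟩ hex⟩
    obtain ⟨i₀, hi₀⟩ := hex
    have hS : Respects (extAdj G A) ![{Sum.inr true}, Sum.inl '' {x | FullTo G A x},
        Sum.inl '' {x | InCore G A x}, Sum.inl '' {x | MixedOn G A x},
        Sum.inl '' {x | AntiTo G A x ∧ ¬ InCore G A x}] := by
      refine Respects.of_classes (extAdj_symm G A) ?_ ?_ ?_ ?_ ?_ ?_ ?_ ?_
      · rintro _ rfl _ ⟨y, hy, rfl⟩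
        exact hy
      · rintro _ rfl _ ⟨y, hy, rfl⟩
        exact fun h => h.not_anti hA hy.1
      · rintro _ rfl _ ⟨y, hy, rfl⟩
        exact fun h => h.not_anti hA hy.1
      · rintro _ ⟨x, hx, rfl⟩ _ ⟨y, hy, rfl⟩
        exact h.mixed_full x y hx hy
      · rintro _ ⟨x, hx, rfl⟩ _ ⟨y, hy, rfl⟩
        exact h.mixed_core x y hx hy
      · rintro _ ⟨x, hx, rfl⟩ _ ⟨y, hy, rfl⟩
        exact fun h => hx.2 ⟨hx.1, y, hy.1, h⟩
      · rintro _ ⟨x, hx, rfl⟩ _ ⟨y, hy, rfl⟩ hxy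
        exact h.mixed_clique x y hx hy fun e => hxy (congrArg _ e)
      · rintro _ ⟨x, hx, rfl⟩ _ ⟨y, hy, rfl⟩ -
        exact fun h => hx.2 ⟨hx.1, y, hy.1, h⟩
    obtain ⟨l, hl⟩ := exists_label (A := {Sum.inr true}) (B := Sum.inl '' {x | FullTo G A x})
      (C := Sum.inl '' {x | InCore G A x}) (L := Sum.inl '' {x | MixedOn G A x})
      (T := Sum.inl '' {x | AntiTo G A x ∧ ¬ InCore G A x}) (f := f) fun i => by
        rcases hf i with ⟨x, ((hx | hx) | hx) | hx, e⟩ | e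
        · exact Or.inl (Or.inl (Or.inl (Or.inr ⟨x, hx, e⟩)))
        · exact Or.inl (Or.inl (Or.inr ⟨x, hx, e⟩))
        · exact Or.inl (Or.inr ⟨x, hx, e⟩)
        · exact Or.inr ⟨x, hx, e⟩
        · exact Or.inl (Or.inl (Or.inl (Or.inl e)))
    have five : ∀ k : Fin 5, k = 0 ∨ k = 1 ∨ k = 2 ∨ k = 3 ∨ k = 4 := by decide
    have hl0 : ∀ i, l i = 0 → f i = Sum.inr true := fun i hi => by
      have := hl i
      rw [hi] at this
      exact this
    have hl3 : ∀ i, l i = 3 → ∃ x, MixedOn G A x ∧ f i = Sum.inl x := fun i hi => by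
      have := hl i
      rw [hi] at this
      obtain ⟨x, hx, e⟩ := this
      exact ⟨x, hx, e.symm⟩
    have hli₀ : l i₀ = 0 := by
      have := hl i₀
      rw [hi₀] at this
      rcases five (l i₀) with e | e | e | e | e <;> rw [e] at this
      · exact e
      all_goals
        obtain ⟨x, -, hx⟩ := this
        exact absurd hx (by simp)
    have hmix : ∀ j x, f j = Sum.inl x → MixedOn G A x → l j = 3 := fun j x hj hx => by
      have := hl j
      rw [hj] at this
      rcases five (l j) with e | e | e | e | e <;> rw [e] at this
      · exact absurd this (by simp)
      · obtain ⟨y, hy, hxy⟩ := this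
        obtain rfl := Sum.inl_injective hxy
        exact absurd hy hx.not_full
      · obtain ⟨y, hy, hxy⟩ := this
        obtain rfl := Sum.inl_injective hxy
        exact absurd hy.1 hx.not_anti
      · exact e
      · obtain ⟨y, hy, hxy⟩ := this
        obtain rfl := Sum.inl_injective hxy
        exact absurd hy.1 hx.not_anti
    have huniq := label_unique_clique hM l (hS.labelOK hM hcopy' hl) i₀ hli₀
      (fun j hj => hcopy'.injective hM ((hl0 j hj).trans hi₀.symm)) fun j hj => by
        obtain ⟨x, hx, e⟩ := hl3 j hj
        rw [← Bool.not_eq_true, ← hcopy' i₀ j, hi₀, e]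
        exact hx.not_full
    by_cases hex : ∃ j, l j = 3
    · obtain ⟨j, hj⟩ := hex
      obtain ⟨x, hx, e⟩ := hl3 j hj
      obtain ⟨-, -, a, ha, hxa⟩ := id hx
      refine ⟨a, ha, fun _ _ k y hk hy => ?_⟩
      obtain rfl := huniq j k hj (hmix k y hk hy)
      rw [e] at hk
      rwa [← Sum.inl_injective hk]
    · obtain ⟨a, ha⟩ := hA
      exact ⟨a, ha, fun _ _ k y hk hy => absurd ⟨k, hmix k y hk hy⟩ hex⟩
  refine hG M hM (fun i => Sum.elim id (fun _ => a) (f i)) fun i j => ?_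
  rw [← hcopy' i j]
  dsimp only
  have key : ∀ i j x, f i = Sum.inr true → f j = Sum.inl x →
      x ∈ {x | FullTo G A x} ∪ {x | InCore G A x} ∪
      {x | MixedOn G A x} ∪ {x | AntiTo G A x ∧ ¬ InCore G A x} →
      (G.Adj a x ↔ FullTo G A x) := by
    rintro i j x hi hj (((hx | hx) | hx) | hx)
    · exact iff_of_true (hx.2 a ha).symm hx
    · exact iff_of_false (fun h => hx.1.2 a ha h.symm) fun h => h.not_anti hA hx.1
    · exact iff_of_false (fun h => hna i hi j x hj hx h.symm) hx.not_full
    · exact iff_of_false (fun h => hx.1.2 a ha h.symm) fun h => h.not_anti hA hx.1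
  rcases hf i with ⟨x, hx, e⟩ | e <;> rcases hf j with ⟨y, hy, e'⟩ | e'
  · rw [← e, ← e']; rfl
  · have := key j i x e' e.symm hx
    rw [← e, e', G.adj_comm]
    exact this
  · have := key i j y e e'.symm hy
    rw [← e', e]
    exact this
  · rw [e, e']
    exact iff_of_false (fun h => h.ne rfl) id

end Divide

theorem IsDivide.obtainedBySplitUnification {V : Type*} [Finite V] {G : SimpleGraph V} {A : Set V}
    (h : IsDivide G A) (hG : IsP5HouseFree G) :
    ObtainedBySplitUnification (IsSmallerFree V) G := by
  have hA := h.nontrivial.nonempty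
  obtain ⟨a₁, ha₁, a₂, ha₂, ha⟩ := id h.nontrivial
  obtain ⟨c, hc⟩ := id h.exists_core
  obtain ⟨c', hc', hcc'⟩ := id hc.2
  set B : Set V := {x | FullTo G A x} with hB
  set C : Set V := {x | InCore G A x} with hC
  set L : Set V := {x | MixedOn G A x} with hL
  set T : Set V := {x | AntiTo G A x ∧ ¬ InCore G A x} with hT
  have hcC' : c' ∈ C := ⟨hc', c, hc.1, hcc'.symm⟩
  have hdAB : Disjoint A B := Set.disjoint_left.2 fun x hx hx' => hx'.1 hx
  have hdAC : Disjoint A C := Set.disjoint_left.2 fun x hx hx' => hx'.1.1 hx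
  have hdAL : Disjoint A L := Set.disjoint_left.2 fun x hx hx' => hx'.1 hx
  have hdAT : Disjoint A T := Set.disjoint_left.2 fun x hx hx' => hx'.1.1 hx
  have hdBC : Disjoint B C := Set.disjoint_left.2 fun x hx hx' => FullTo.not_anti hA hx hx'.1
  have hdBL : Disjoint B L := Set.disjoint_left.2 fun x hx hx' => MixedOn.not_full hx' hx
  have hdBT : Disjoint B T := Set.disjoint_left.2 fun x hx hx' => FullTo.not_anti hA hx hx'.1
  have hdCL : Disjoint C L := Set.disjoint_left.2 fun x hx hx' => MixedOn.not_anti hx' hx.1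
  have hdCT : Disjoint C T := Set.disjoint_left.2 fun x hx hx' => hx'.2 hx
  have hdLT : Disjoint L T := Set.disjoint_left.2 fun x hx hx' => MixedOn.not_anti hx hx'.1
  have hinl : Function.Injective (Sum.inl : V → V ⊕ Bool) := Sum.inl_injective
  have hcover : (Sum.inl '' A ∪ Sum.inl '' B ∪ Sum.inl '' C ∪ Sum.inl '' L ∪ Sum.inl '' T :
      Set (V ⊕ Bool)) = Set.range Sum.inl := by
    rw [← Set.image_union, ← Set.image_union, ← Set.image_union, ← Set.image_union,
      ← Set.image_univ]
    congr 1
    rw [Set.eq_univ_iff_forall]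
    intro x
    rcases mem_or_full_or_core_or_mixed_or_anti G A x with hx | hx | hx | hx | hx
    · exact Or.inl (Or.inl (Or.inl (Or.inl hx)))
    · exact Or.inl (Or.inl (Or.inl (Or.inr hx)))
    · exact Or.inl (Or.inl (Or.inr hx))
    · exact Or.inl (Or.inr hx)
    · exact Or.inr hx
  have himL : (Sum.inl '' A ∪ Sum.inl '' L ∪ Sum.inl '' T : Set (V ⊕ Bool)) =
      Sum.inl '' (A ∪ L ∪ T) := by simp only [Set.image_union]
  have himR : (Sum.inl '' B ∪ Sum.inl '' C ∪ Sum.inl '' L ∪ Sum.inl '' T : Set (V ⊕ Bool)) =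
      Sum.inl '' (B ∪ C ∪ L ∪ T) := by simp only [Set.image_union]
  refine ⟨V ⊕ Bool, inferInstance, Sum.inl '' A, Sum.inl '' B, Sum.inl '' C, Sum.inl '' L,
    Sum.inl '' T, Sum.inr true, Sum.inr false,
    (extGraph G A).induce (Sum.inl '' (A ∪ L ∪ T) ∪ {Sum.inr false}),
    (extGraph G A).induce (Sum.inl '' (B ∪ C ∪ L ∪ T) ∪ {Sum.inr true}),
    (extGraph G A).induce (Set.range Sum.inl),
    ⟨⟨?_, hA.image _, ⟨_, c, hc, rfl⟩, by simp, by rw [hcover]; simp, by rw [hcover]; simp,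
      by rw [himL]; rfl, ?_, ?_, ?_, ?_, ?_, by rw [himR]; rfl, ?_, ?_, ?_, ?_, ?_⟩,
      by rw [hcover]; rfl, ?_, ?_, ?_, ?_⟩, ?_, ⟨?_, h.free_left hG⟩, ⟨?_, h.free_right hG⟩⟩
  · simp only [List.pairwise_cons, List.mem_cons, forall_eq_or_imp, List.not_mem_nil,
      Set.disjoint_image_iff hinl]
    simp [hdAB, hdAC, hdAL, hdAT, hdBC, hdBL, hdBT, hdCL, hdCT, hdLT]
  · rintro _ ⟨x, hx, rfl⟩ _ ⟨y, hy, rfl⟩ hxy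
    rw [SimpleGraph.Subgraph.induce_adj]
    exact ⟨Or.inl ⟨x, by simp [hx], rfl⟩, Or.inl ⟨y, by simp [hy], rfl⟩,
      h.mixed_clique x y hx hy fun e => hxy (congrArg _ e)⟩
  · rintro _ ⟨x, hx, rfl⟩ _ ⟨y, hy, rfl⟩ hxy hadj
    exact hx.2 ⟨hx.1, y, hy.1, hadj.2.2⟩
  · rintro _ ⟨x, hx, rfl⟩ _ ⟨y, hy, rfl⟩ hadj
    exact hy.1.2 x hx (G.symm.symm _ _ hadj.2.2)
  · rintro _ rfl _ ⟨y, hy, rfl⟩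
    rw [SimpleGraph.Subgraph.induce_adj]
    exact ⟨Or.inr rfl, Or.inl ⟨y, by simp [hy], rfl⟩, hy⟩
  · rintro _ rfl _ (⟨y, hy, rfl⟩ | ⟨y, hy, rfl⟩) hadj
    · have h2 : MixedOn G A y := hadj.2.2
      exact h2.1 hy
    · have h2 : MixedOn G A y := hadj.2.2
      exact h2.not_anti hy.1
  · rw [← Set.image_union, induce_induce_of_subset, induce_induce_of_subset]
    · exact (Set.image_mono fun x hx => by
        rcases hx with hx | hx <;> simp [hx]).trans Set.subset_union_left
    · exact (Set.image_mono fun x hx => by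
        rcases hx with hx | hx <;> simp [hx]).trans Set.subset_union_left
  · rintro _ ⟨x, hx, rfl⟩ _ ⟨y, hy, rfl⟩ hadj
    exact hx.2 ⟨hx.1, y, hy.1, hadj.2.2⟩
  · rintro _ ⟨x, hx, rfl⟩ _ (⟨y, hy, rfl⟩ | ⟨y, hy, rfl⟩) <;>
      rw [SimpleGraph.Subgraph.induce_adj]
    · exact ⟨Or.inl ⟨x, by simp [hx], rfl⟩, Or.inl ⟨y, by simp [hy], rfl⟩,
        h.mixed_full x y hx hy⟩
    · exact ⟨Or.inl ⟨x, by simp [hx], rfl⟩, Or.inl ⟨y, by simp [hy], rfl⟩,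
        h.mixed_core x y hx hy⟩
  · rintro _ rfl _ ⟨y, hy, rfl⟩
    rw [SimpleGraph.Subgraph.induce_adj]
    exact ⟨Or.inr rfl, Or.inl ⟨y, by simp [hy], rfl⟩, hy⟩
  · rintro _ rfl _ ((⟨y, hy, rfl⟩ | ⟨y, hy, rfl⟩) | ⟨y, hy, rfl⟩) hadj
    · exact FullTo.not_anti hA hadj.2.2 hy.1
    · exact MixedOn.not_full hy hadj.2.2
    · exact FullTo.not_anti hA hadj.2.2 hy.1
  · rw [himL, induce_induce_of_subset _ (Set.image_subset_range _ _),
      deleteVerts_induce_union_singleton _ (by simp)]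
  · rw [himR, induce_induce_of_subset _ (Set.image_subset_range _ _),
      deleteVerts_induce_union_singleton _ (by simp)]
  · rintro _ ⟨x, hx, rfl⟩ _ ⟨y, hy, rfl⟩
    rw [SimpleGraph.Subgraph.induce_adj]
    exact ⟨⟨x, rfl⟩, ⟨y, rfl⟩, (hy.2 x hx).symm⟩
  · rintro _ ⟨x, hx, rfl⟩ _ ⟨y, hy, rfl⟩ hadj
    exact hy.1.2 x hx (G.symm.symm _ _ hadj.2.2)
  · refine ⟨⟨Equiv.ofInjective Sum.inl hinl, fun {x y} => ?_⟩⟩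
    change ((extGraph G A).induce (Set.range Sum.inl)).Adj (Sum.inl x) (Sum.inl y) ↔ _
    rw [SimpleGraph.Subgraph.induce_adj]
    simp [extGraph, extAdj]
  · refine card_image_inl_union_lt _ _ hcc'.ne ?_ ?_
    · rintro ((hx | hx) | hx)
      exacts [hc.1.1 hx, MixedOn.not_anti hx hc.1, hx.2 hc]
    · rintro ((hx | hx) | hx)
      exacts [hcC'.1.1 hx, MixedOn.not_anti hx hcC'.1, hx.2 hcC']
  · refine card_image_inl_union_lt _ _ ha ?_ ?_
    · rintro (((hx | hx) | hx) | hx)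
      exacts [hx.1 ha₁, hx.1.1 ha₁, hx.1 ha₁, hx.1.1 ha₁]
    · rintro (((hx | hx) | hx) | hx)
      exacts [hx.1 ha₂, hx.1.1 ha₂, hx.1 ha₂, hx.1.1 ha₂]

/-! ### Existence of a divide in a prime graph with an induced $2K_2$ -/

section Decomposition

variable {V : Type*} {G : SimpleGraph V} {A : Set V}

/-- `A` induces a connected subgraph: every bipartition of `A` is crossed by an edge. -/
def ConnOn (G : SimpleGraph V) (A : Set V) : Prop :=
  ∀ S : Set V, (∃ a ∈ A, a ∈ S) → (∃ a ∈ A, a ∉ S) → ∃ a ∈ A, ∃ a' ∈ A, a ∈ S ∧ a' ∉ S ∧ G.Adj a a'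

theorem ConnOn.insert (h : ConnOn G A) {v u : V} (hu : u ∈ A) (hvu : G.Adj v u) :
    ConnOn G (insert v A) := by
  rintro S ⟨a, ha, haS⟩ ⟨b, hb, hbS⟩
  by_cases h₁ : ∃ a ∈ A, a ∈ S
  · by_cases h₂ : ∃ a ∈ A, a ∉ S
    · obtain ⟨x, hx, y, hy, hxy⟩ := h S h₁ h₂
      exact ⟨x, Or.inr hx, y, Or.inr hy, hxy⟩
    · push Not at h₂
      obtain rfl : b = v := hb.resolve_right fun hb => hbS (h₂ b hb)
      exact ⟨u, Or.inr hu, b, Or.inl rfl, h₂ u hu, hbS, hvu.symm⟩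
  · push Not at h₁
    obtain rfl : a = v := ha.resolve_right fun ha => h₁ a ha haS
    exact ⟨a, Or.inl rfl, u, Or.inr hu, haS, h₁ u hu, hvu⟩

theorem ConnOn.star {x : V} (h : ∀ y ∈ A, G.Adj x y) : ConnOn G (Insert.insert x A) := by
  rintro S ⟨a, ha, haS⟩ ⟨b, hb, hbS⟩
  by_cases hx : x ∈ S
  · rcases hb with rfl | hb
    · exact absurd hx hbS
    · exact ⟨x, Or.inl rfl, b, Or.inr hb, hx, hbS, h b hb⟩
  · rcases ha with rfl | ha
    · exact absurd haS hx
    · exact ⟨a, Or.inr ha, x, Or.inl rfl, haS, hx, (h a ha).symm⟩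

theorem ConnOn.pair {x y : V} (h : G.Adj x y) : ConnOn G {x, y} :=
  ConnOn.star (by rintro _ rfl; exact h)

theorem ConnOn.exists_edge (h : ConnOn G A) {v : V} (hv : MixedOn G A v) :
    ∃ a ∈ A, ∃ a' ∈ A, G.Adj v a ∧ ¬ G.Adj v a' ∧ G.Adj a a' :=
  h {a | G.Adj v a} hv.2.1 hv.2.2

/-- Connectedness gives an edge $aa'$ of $A$ with $v$ adjacent to $a$ only. If $v$ missed $y'$, then
$a',a,v,y,y'$ would be an induced path. -/
theorem IsP5HouseFree.adj_of_mixed (hG : IsP5HouseFree G) (hA : ConnOn G A) {v y y' : V}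
    (hv : MixedOn G A v) (hy : AntiTo G A y) (hy' : AntiTo G A y') (hyy' : G.Adj y y')
    (hvy : G.Adj v y) : G.Adj v y' := by
  by_contra hvy'
  obtain ⟨a, ha, a', ha', hva, hva', haa'⟩ := hA.exists_edge hv
  exact hG.no_path haa'.symm hva.symm hvy hyy' (fun h => hva' h.symm)
    (fun h => hy.2 _ ha' h.symm) (fun h => hy'.2 _ ha' h.symm) (fun h => hy.2 _ ha h.symm)
    (fun h => hy'.2 _ ha h.symm) hvy'

/-- With $aa'$ an edge of $A$ of which $v$ sees only $a$, non-adjacency of $v$ and $b$ would make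
$a,b,y,v$ a four-cycle with roof $a'$ over $ab$. -/
theorem IsP5HouseFree.adj_full_of_mixed (hG : IsP5HouseFree G) (hA : ConnOn G A) {v b y : V}
    (hv : MixedOn G A v) (hb : FullTo G A b) (hy : AntiTo G A y) (hvy : G.Adj v y)
    (hby : G.Adj b y) : G.Adj v b := by
  by_contra hvb
  obtain ⟨a, ha, a', ha', hva, hva', haa'⟩ := hA.exists_edge hv
  exact hG.no_house (hb.2 a ha).symm hby hvy.symm hva haa'.symm (hb.2 a' ha').symm
    (fun h => hy.2 a ha h.symm) (fun h => hvb h.symm) (fun h => hy.2 a' ha' h.symm)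
    (fun h => hva' h.symm)

/-- A connected set with at least two vertices that leaves an edge anti-complete to it. -/
def IsSeparated (G : SimpleGraph V) (A : Set V) : Prop :=
  A.Nontrivial ∧ ConnOn G A ∧ ∃ c, InCore G A c

theorem not_maximal_of_insert (hA : Maximal (IsSeparated G) A) {v u y y' : V} (hv : v ∉ A)
    (hu : u ∈ A) (hvu : G.Adj v u) (hy : AntiTo G A y) (hy' : AntiTo G A y') (hyy' : G.Adj y y')
    (hvy : ¬ G.Adj v y) (hvy' : ¬ G.Adj v y') : False := by
  have key : ∀ w, AntiTo G A w → ¬ G.Adj v w → AntiTo G (insert v A) w := by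
    intro w hw hvw
    constructor
    · rintro (rfl | h)
      exacts [hw.2 u hu hvu, hw.1 h]
    · rintro a (rfl | ha)
      exacts [fun h => hvw h.symm, hw.2 a ha]
  refine hv (hA.2 ⟨hA.1.1.mono (Set.subset_insert _ _), hA.1.2.1.insert hu hvu, y, key y hy hvy, y',
    key y' hy' hvy', hyy'⟩ (Set.subset_insert _ _) (Set.mem_insert _ _))

/-- If $x$ misses one end of a core edge it misses the other by `adj_of_mixed`, and then
$A\cup\{x\}$ contradicts maximality. -/
theorem mixed_core_of_maximal (hG : IsP5HouseFree G) (hA : Maximal (IsSeparated G) A) (x c : V)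
    (hx : MixedOn G A x) (hc : InCore G A c) : G.Adj x c := by
  by_contra hxc
  obtain ⟨hc, c', hc', hcc'⟩ := hc
  obtain ⟨a, ha, hxa⟩ := hx.2.1
  exact not_maximal_of_insert hA hx.1 ha hxa hc hc' hcc' hxc fun h =>
    hxc (hG.adj_of_mixed hA.1.2.1 hx hc' hc hcc'.symm h)

/-- By maximality $b$ sees an end of any core edge. That end is also a neighbour of $x$, so
`adj_full_of_mixed` applies. -/
theorem mixed_full_of_maximal (hG : IsP5HouseFree G) (hA : Maximal (IsSeparated G) A) (x b : V)
    (hx : MixedOn G A x) (hb : FullTo G A b) : G.Adj x b := by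
  obtain ⟨c, hc, c', hc', hcc'⟩ := hA.1.2.2
  obtain ⟨a, ha⟩ := hA.1.1.nonempty
  by_cases h₁ : G.Adj b c
  · exact hG.adj_full_of_mixed hA.1.2.1 hx hb hc
      (mixed_core_of_maximal hG hA x c hx ⟨hc, c', hc', hcc'⟩) h₁
  by_cases h₂ : G.Adj b c'
  · exact hG.adj_full_of_mixed hA.1.2.1 hx hb hc'
      (mixed_core_of_maximal hG hA x c' hx ⟨hc', c, hc, hcc'.symm⟩) h₂
  exact (not_maximal_of_insert hA hb.1 ha (hb.2 a ha) hc hc' hcc' h₁ h₂).elim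

/-- No proper homogeneous set. -/
def IsPrime (G : SimpleGraph V) : Prop :=
  ∀ X : Set V, X.Nontrivial → X ≠ Set.univ → ∃ v ∉ X, (∃ x ∈ X, G.Adj v x) ∧ ∃ x ∈ X, ¬ G.Adj v x

/-- No induced cycle of length five. -/
def NoC5 (G : SimpleGraph V) : Prop :=
  ∀ a b c d e, G.Adj a b → G.Adj b c → G.Adj c d → G.Adj d e → G.Adj e a → ¬ G.Adj a c →
    ¬ G.Adj b d → ¬ G.Adj c e → ¬ G.Adj d a → ¬ G.Adj e b → False

/-- The maximal nontrivial co-connected subsets of `W`. -/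
def IsCocomponent (G : SimpleGraph V) (W Z : Set V) : Prop :=
  Maximal (fun Z => ConnOn Gᶜ Z ∧ Z ⊆ W) Z ∧ Z.Nontrivial

theorem IsCocomponent.mem {W Z : Set V} (h : IsCocomponent G W Z) {w z : V} (hw : w ∈ W)
    (hz : z ∈ Z) (hwz : Gᶜ.Adj w z) : w ∈ Z :=
  h.1.2 ⟨h.1.1.1.insert hz hwz, Set.insert_subset hw h.1.1.2⟩ (Set.subset_insert _ _)
    (Set.mem_insert _ _)

theorem exists_isCocomponent [Finite V] {W : Set V} {w w' : V} (hw : w ∈ W) (hw' : w' ∈ W)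
    (h : Gᶜ.Adj w w') : ∃ Z, IsCocomponent G W Z ∧ w ∈ Z ∧ w' ∈ Z := by
  obtain ⟨Z, hZ, hmax⟩ := Finite.exists_le_maximal (p := fun Z => ConnOn Gᶜ Z ∧ Z ⊆ W)
    (a := ({w, w'} : Set V)) ⟨ConnOn.pair h, by rintro _ (rfl | rfl) <;> assumption⟩
  have h1 := hZ (Set.mem_insert _ _)
  have h2 := hZ (Set.mem_insert_of_mem _ rfl)
  exact ⟨Z, ⟨hmax, w, h1, w', h2, h.ne⟩, h1, h2⟩

/-- Otherwise neighbours $x,x'\in A$ of $z,z'$ and a core vertex $y$ give the sequence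
$x,z,y,z',x'$, an induced pentagon or path according to whether $x$ and $x'$ are adjacent. -/
theorem exists_common_neighbour (hG : IsP5HouseFree G) (hC5 : NoC5 G)
    (hA : Maximal (IsSeparated G) A) {z z' : V} (hz : MixedOn G A z) (hz' : MixedOn G A z')
    (hzz' : ¬ G.Adj z z') : ∃ x ∈ A, G.Adj z x ∧ G.Adj z' x := by
  by_contra! hno
  obtain ⟨y, hy⟩ := hA.1.2.2
  have hzy := mixed_core_of_maximal hG hA z y hz hy
  have hzy' := mixed_core_of_maximal hG hA z' y hz' hy
  obtain ⟨x, hx, hzx⟩ := hz.2.1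
  obtain ⟨x', hx', hzx'⟩ := hz'.2.1
  have h₁ := hno x hx hzx
  have h₂ : ¬ G.Adj z x' := fun h => hno x' hx' h hzx'
  have h₃ := hy.1.2 x hx
  have h₄ := hy.1.2 x' hx'
  by_cases hxx' : G.Adj x x'
  · exact hC5 x z y z' x' hzx.symm hzy hzy'.symm hzx' hxx'.symm (fun h => h₃ h.symm) hzz' h₄
      h₁ (fun h => h₂ h.symm)
  · exact hG.no_path hzx.symm hzy hzy'.symm hzx' (fun h => h₃ h.symm) (fun h => h₁ h.symm) hxx'
      hzz' h₂ h₄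

/-- Primality supplies a vertex that distinguishes two core vertices. Only a full vertex can: mixed
vertices see the whole core, and the others outside the core see none of it. -/
theorem exists_full_not_adj_core (hprime : IsPrime G) (hA : A.Nonempty)
    (hcore : ∃ c, InCore G A c) (hmc : ∀ x c, MixedOn G A x → InCore G A c → G.Adj x c) :
    ∃ b c, FullTo G A b ∧ InCore G A c ∧ ¬ G.Adj b c := by
  obtain ⟨c, hc, c', hc', hcc'⟩ := hcore
  obtain ⟨a, ha⟩ := hA
  obtain ⟨v, hv, ⟨x, hx, hvx⟩, y, hy, hvy⟩ := hprime {c | InCore G A c}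
    ⟨c, ⟨hc, c', hc', hcc'⟩, c', ⟨hc', c, hc, hcc'.symm⟩, hcc'.ne⟩
    fun h => ((h ▸ Set.mem_univ a : a ∈ {c | InCore G A c}).1).1 ha
  refine ⟨v, y, ?_, hy, hvy⟩
  rcases mem_or_full_or_core_or_mixed_or_anti G A v with h | h | h | h | h
  · exact (hx.1.2 v h hvx.symm).elim
  · exact h
  · exact (hv h).elim
  · exact (hvy (hmc v y h hy)).elim
  · exact (h.2 ⟨h.1, x, hx.1, hvx⟩).elim

/-- The divide is a cocomponent of the set $W$ of vertices complete to a co-connected set $Q$. In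
$\overline G$ such a cocomponent is connected and anti-complete to $Q$, so the lemmas on mixed
vertices apply there. Choosing it minimal for a suitable order replaces the maximality used in $G$.
-/
theorem exists_isDivide_compl [Finite V] (hG : IsP5HouseFree G) (hC5 : NoC5 G)
    (hprime : IsPrime G) (hA : Maximal (IsSeparated G) A) {z z' : V} (hz : MixedOn G A z)
    (hz' : MixedOn G A z') (hne : z ≠ z') (hzz' : ¬ G.Adj z z') : ∃ Z, IsDivide Gᶜ Z := by
  have hmc := mixed_core_of_maximal hG hA
  have hmf := mixed_full_of_maximal hG hA
  obtain ⟨x₁, hx₁, hzx₁, hzx₁'⟩ := exists_common_neighbour hG hC5 hA hz hz' hzz'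
  obtain ⟨b₀, c₀, hb₀, hc₀, hbc⟩ := exists_full_not_adj_core hprime hA.1.1.nonempty hA.1.2.2 hmc
  have hbc' : b₀ ≠ c₀ := by
    rintro rfl
    exact hb₀.not_anti hA.1.1.nonempty hc₀.1
  have hHfree := hG.compl
  -- Each member of $Q$ has a role: a vertex with no neighbour in $Q$ is outside $A$ because of
  -- $b_0$, not full because of $x_1$, and neither core nor mixed because of the core. The choice of
  -- $x_1$ as a common neighbour puts $z,z'$ in $W$.
  set Q : Set V := insert b₀ (insert x₁ {c | InCore G A c}) with hQdef
  have hb₀Q : b₀ ∈ Q := Or.inl rfl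
  have hx₁Q : x₁ ∈ Q := Or.inr (Or.inl rfl)
  have hCQ : ∀ c, InCore G A c → c ∈ Q := fun c hc => Or.inr (Or.inr hc)
  have hQ : ConnOn Gᶜ Q := by
    refine (ConnOn.star fun c hc => ?_).insert (Or.inr hc₀) ?_
    · rw [SimpleGraph.compl_adj]
      exact ⟨fun e => hc.1.1 (e ▸ hx₁), fun h => hc.1.2 x₁ hx₁ h.symm⟩
    · rw [SimpleGraph.compl_adj]
      exact ⟨hbc', hbc⟩
  set W : Set V := {w | ∀ q ∈ Q, G.Adj w q} with hWdef
  have hmemW : ∀ w, MixedOn G A w → G.Adj w x₁ → w ∈ W := by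
    rintro w hw hwx q (rfl | rfl | hq)
    exacts [hmf w q hw hb₀, hwx, hmc w q hw hq]
  have hQanti : ∀ Z ⊆ W, ∀ q ∈ Q, AntiTo Gᶜ Z q := fun Z hZ q hq =>
    ⟨fun h => (hZ h q hq).ne rfl, fun w hw h => ((SimpleGraph.compl_adj _ _ _).1 h).2
      (hZ hw q hq).symm⟩
  have hstable : ∀ t t', (AntiTo G A t ∧ ¬ InCore G A t) → (AntiTo G A t' ∧ ¬ InCore G A t') →
      ¬ G.Adj t t' := fun t t' ht ht' h => ht.2 ⟨ht.1, t', ht'.1, h⟩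
  have hunif : ∀ Z, IsCocomponent G W Z → ∀ s, MixedOn Gᶜ Z s → ∀ Y, ConnOn Gᶜ Y →
      (∀ y ∈ Y, AntiTo Gᶜ Z y) → ∀ y ∈ Y, ∀ y' ∈ Y, Gᶜ.Adj s y → Gᶜ.Adj s y' := by
    intro Z hZ s hs Y hY hYZ y hy y' hy' h
    by_contra h'
    obtain ⟨u, hu, u', hu', hsu, hsu', huu'⟩ := hY {y | Gᶜ.Adj s y} ⟨y, hy, h⟩ ⟨y', hy', h'⟩
    exact hsu' (hHfree.adj_of_mixed hZ.1.1.1 hs (hYZ u hu) (hYZ u' hu') huu' hsu)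
  have hmixed : ∀ Z, IsCocomponent G W Z → ∀ s, MixedOn Gᶜ Z s →
      (AntiTo G A s ∧ ¬ InCore G A s) ∧ ∀ q ∈ Q, ¬ G.Adj s q := by
    intro Z hZ s hs
    have hQZ := hQanti Z hZ.1.1.2
    have hsQ : ∀ q ∈ Q, s ≠ q := by
      rintro q hq rfl
      exact hs.not_anti (hQZ _ hq)
    -- Since $Q$ is co-connected, $s$ is complete or anti-complete to it in $G$. In the former case
    -- $s\in W$, and a non-neighbour in $Z$ would draw $s$ into the cocomponent $Z$.
    have hall : ∀ q ∈ Q, Gᶜ.Adj s q := by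
      by_contra! hex
      obtain ⟨q, hq, hsq⟩ := hex
      have hsW : s ∈ W := fun q' hq' => by
        by_contra hadj
        exact hsq (hunif Z hZ s hs Q hQ hQZ q' hq' q hq
          ((SimpleGraph.compl_adj _ _ _).2 ⟨hsQ q' hq', hadj⟩))
      obtain ⟨w, hw, hsw⟩ := hs.2.1
      exact hs.1 (hZ.mem hsW hw hsw)
    have hall' : ∀ q ∈ Q, ¬ G.Adj s q := fun q hq => ((SimpleGraph.compl_adj _ _ _).1 (hall q hq)).2
    refine ⟨?_, hall'⟩
    rcases mem_or_full_or_core_or_mixed_or_anti G A s with h | h | h | h | h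
    · exact (hall' b₀ hb₀Q (hb₀.2 s h).symm).elim
    · exact (hall' x₁ hx₁Q (h.2 x₁ hx₁)).elim
    · exact (hsQ s (hCQ s h) rfl).elim
    · exact (hall' c₀ (hCQ _ hc₀) (hmc s c₀ h hc₀)).elim
    · exact h
  have hzW := hmemW z hz hzx₁
  have hzW' := hmemW z' hz' hzx₁'
  -- A strict order on cocomponents. Minimality of $Z$ means that no vertex mixed on $Z$ is complete
  -- in $G$ to a cocomponent.
  let r : Set V → Set V → Prop := fun Z₂ Z₁ => IsCocomponent G W Z₁ ∧ IsCocomponent G W Z₂ ∧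
    ∃ p, MixedOn Gᶜ Z₁ p ∧ ∀ w ∈ Z₂, G.Adj p w
  have hirrefl : ∀ Z, ¬ r Z Z := by
    rintro Z ⟨-, -, p, hp, h⟩
    obtain ⟨w, hw, hpw⟩ := hp.2.1
    exact ((SimpleGraph.compl_adj _ _ _).1 hpw).2 (h w hw)
  have htrans : ∀ Z₃ Z₂ Z₁, r Z₃ Z₂ → r Z₂ Z₁ → r Z₃ Z₁ := by
    rintro Z₃ Z₂ Z₁ ⟨hZ₂, hZ₃, p₂, hp₂, hp₂Z₃⟩ ⟨hZ₁, -, p₁, hp₁, hp₁Z₂⟩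
    refine ⟨hZ₁, hZ₃, p₁, hp₁, fun z₃ hz₃ => ?_⟩
    by_contra hpz
    obtain ⟨u', hu', u, hu, hpu', hpu, huu'⟩ := hZ₂.1.1.1.exists_edge hp₂
    rw [SimpleGraph.compl_adj] at hpu' hpu huu'
    have hpu2 : G.Adj p₂ u := by
      by_contra h
      exact hpu ⟨fun e => hp₂.1 (e ▸ hu), h⟩
    have hz₃adj : ∀ w ∈ Z₂, G.Adj z₃ w := fun w hw => by
      by_contra h
      refine hpz (hp₁Z₂ z₃ ?_)
      by_cases e : z₃ = w
      · exact e ▸ hw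
      · exact hZ₂.mem (hZ₃.1.1.2 hz₃) hw ((SimpleGraph.compl_adj _ _ _).2 ⟨e, h⟩)
    -- The four-cycle is $u,z_3,u',p_1$ with roof $p_2$ over $uz_3$; $p_1$ and $p_2$ are
    -- non-adjacent because both lie in the stable set $T$ of $A$.
    exact hG.no_house (hz₃adj u hu).symm (hz₃adj u' hu') (hp₁Z₂ u' hu').symm (hp₁Z₂ u hu) hpu2
      (hp₂Z₃ z₃ hz₃) (fun h => huu'.2 h.symm) (fun h => hpz h.symm) hpu'.2
      (hstable _ _ (hmixed Z₂ hZ₂ p₂ hp₂).1 (hmixed Z₁ hZ₁ p₁ hp₁).1)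
  have : IsTrans (Set V) r := ⟨htrans⟩
  have : Std.Irrefl r := ⟨hirrefl⟩
  obtain ⟨Z₀, hZ₀, -⟩ := exists_isCocomponent hzW hzW' ((SimpleGraph.compl_adj _ _ _).2 ⟨hne, hzz'⟩)
  obtain ⟨Z, hZ, hmin⟩ := (Finite.wellFounded_of_trans_of_irrefl r).has_min
    {Z | IsCocomponent G W Z} ⟨Z₀, hZ₀⟩
  have hQZ := hQanti Z hZ.1.1.2
  refine ⟨Z, hZ.2, ⟨b₀, hQZ _ hb₀Q, c₀, hQZ _ (hCQ _ hc₀),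
    (SimpleGraph.compl_adj _ _ _).2 ⟨hbc', hbc⟩⟩, fun s s' hs hs' hss' => ?_, ?_, ?_⟩
  · exact (SimpleGraph.compl_adj _ _ _).2
      ⟨hss', hstable _ _ (hmixed Z hZ s hs).1 (hmixed Z hZ s' hs').1⟩
  · rintro p c hp ⟨hc, c', hc', hcc'⟩
    by_contra hpc
    obtain ⟨hpT, hpQ⟩ := hmixed Z hZ p hp
    -- A non-neighbour of $c$ in $Q$ would carry the co-adjacency of $p$ and $Q$ over to $c$. Hence
    -- $c$ and $c'$ lie in one cocomponent $Z_2$ of $W$, to which $p$ is complete in $G$, against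
    -- the minimality of $Z$.
    have hinW : ∀ c, AntiTo Gᶜ Z c → ¬ Gᶜ.Adj p c → c ∈ W := by
      intro c hc hpc q hq
      have hpq : Gᶜ.Adj p q := (SimpleGraph.compl_adj _ _ _).2
        ⟨fun e => hp.not_anti (e ▸ hQZ q hq), hpQ q hq⟩
      by_contra hcq
      by_cases e : q = c
      · exact hpc (e ▸ hpq)
      · exact hpc (hHfree.adj_of_mixed hZ.1.1.1 hp (hQZ q hq) hc
          ((SimpleGraph.compl_adj _ _ _).2 ⟨e, fun h => hcq h.symm⟩) hpq)
    have hpc' : ¬ Gᶜ.Adj p c' := fun h =>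
      hpc (hHfree.adj_of_mixed hZ.1.1.1 hp hc' hc hcc'.symm h)
    obtain ⟨Z₂, hZ₂, hcZ₂, -⟩ := exists_isCocomponent (hinW c hc hpc) (hinW c' hc' hpc') hcc'
    have hanti : ∀ y ∈ Z₂, AntiTo Gᶜ Z y := by
      by_contra! hex
      obtain ⟨u, hu, u', hu', hsu, hsu', huu'⟩ :=
        hZ₂.1.1.1 {y | AntiTo Gᶜ Z y} ⟨c, hcZ₂, hc⟩ hex
      refine hsu' ⟨fun h => hsu.2 u' h huu', fun w hw h => hsu.2 u' ?_ huu'⟩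
      exact hZ.mem (hZ₂.1.1.2 hu') hw h
    refine hmin Z₂ hZ₂ ⟨hZ, hZ₂, p, hp, fun w hw => ?_⟩
    by_contra hpw
    refine hpc (hunif Z hZ p hp Z₂ hZ₂.1.1.1 hanti w hw c hcZ₂
      ((SimpleGraph.compl_adj _ _ _).2 ⟨fun e => ?_, hpw⟩))
    exact hp.not_anti (e ▸ hanti w hw)
  · intro p b hp hb
    obtain ⟨-, hpQ⟩ := hmixed Z hZ p hp
    by_cases hex : ∃ q ∈ Q, Gᶜ.Adj b q
    · obtain ⟨q, hq, hbq⟩ := hex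
      exact hHfree.adj_full_of_mixed hZ.1.1.1 hp hb (hQZ q hq) ((SimpleGraph.compl_adj _ _ _).2
        ⟨fun e => hp.not_anti (e ▸ hQZ q hq), hpQ q hq⟩) hbq
    · push Not at hex
      have hbW : b ∈ W := fun q hq => by
        by_contra h
        refine hex q hq ((SimpleGraph.compl_adj _ _ _).2 ⟨fun e => ?_, h⟩)
        exact hb.not_anti hZ.2.nonempty (e ▸ hQZ q hq)
      obtain ⟨w, hw⟩ := hZ.2.nonempty
      exact (hb.1 (hZ.mem hbW hw (hb.2 w hw))).elim

theorem exists_isDivide [Finite V] (hG : IsP5HouseFree G) (hC5 : NoC5 G) (hprime : IsPrime G)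
    {a b c d : V} (hab : G.Adj a b) (hcd : G.Adj c d) (hac : ¬ G.Adj a c) (had : ¬ G.Adj a d)
    (hbc : ¬ G.Adj b c) (hbd : ¬ G.Adj b d) : ∃ Z, IsDivide G Z ∨ IsDivide Gᶜ Z := by
  have hsep : IsSeparated G {a, b} := by
    refine ⟨⟨a, by simp, b, by simp, hab.ne⟩, ConnOn.pair hab, c, ⟨?_, ?_⟩, d, ⟨?_, ?_⟩, hcd⟩
    · rintro (rfl | rfl)
      exacts [had hcd, hbd hcd]
    · rintro _ (rfl | rfl) h
      exacts [hac h.symm, hbc h.symm]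
    · rintro (rfl | rfl)
      exacts [hac hcd.symm, hbc hcd.symm]
    · rintro _ (rfl | rfl) h
      exacts [had h.symm, hbd h.symm]
  obtain ⟨A, -, hA⟩ := Finite.exists_le_maximal hsep
  by_cases hcl : ∀ x y, MixedOn G A x → MixedOn G A y → x ≠ y → G.Adj x y
  · exact ⟨A, Or.inl ⟨hA.1.1, hA.1.2.2, hcl, mixed_core_of_maximal hG hA,
      mixed_full_of_maximal hG hA⟩⟩
  · push Not at hcl
    obtain ⟨x, y, hx, hy, hxy, hnadj⟩ := hcl
    obtain ⟨Z, hZ⟩ := exists_isDivide_compl hG hC5 hprime hA hx hy hxy hnadj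
    exact ⟨Z, Or.inr hZ⟩

end Decomposition

/-! ### The Földes–Hammer characterisation of split graphs -/

section Split

variable {V : Type*} {G : SimpleGraph V}

/-- The ordered pairs of adjacent vertices outside `K`. -/
def outsideEdges (G : SimpleGraph V) (K : Set V) : Set (V × V) :=
  {p | p.1 ∉ K ∧ p.2 ∉ K ∧ G.Adj p.1 p.2}

theorem exists_maximum_clique [Finite V] (G : SimpleGraph V) :
    ∃ K : Set V, G.IsClique K ∧ (∀ K', G.IsClique K' → K'.ncard ≤ K.ncard) ∧
      ∀ K', G.IsClique K' → K'.ncard = K.ncard →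
        (outsideEdges G K).ncard ≤ (outsideEdges G K').ncard := by
  obtain ⟨K₀, hK₀, hmax⟩ := Set.exists_max_image {K : Set V | G.IsClique K} Set.ncard
    (Set.toFinite _) ⟨∅, by simp⟩
  obtain ⟨K, hK, hmin⟩ := Set.exists_min_image {K : Set V | G.IsClique K ∧ K.ncard = K₀.ncard}
    (fun K => (outsideEdges G K).ncard) (Set.toFinite _) ⟨K₀, hK₀, rfl⟩
  exact ⟨K, hK.1, fun K' hK' => hK.2 ▸ hmax K' hK', fun K' hK' h => hmin K' ⟨hK', h.trans hK.2⟩⟩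

/-- The theorem of Földes and Hammer. -/
theorem isSplit_of_forbidden [Finite V]
    (h2K2 : ∀ a b c d, G.Adj a b → G.Adj c d → ¬ G.Adj a c → ¬ G.Adj a d → ¬ G.Adj b c →
      ¬ G.Adj b d → False)
    (hC4 : ∀ a b c d, G.Adj a b → G.Adj b c → G.Adj c d → G.Adj d a → a ≠ c → b ≠ d →
      ¬ G.Adj a c → ¬ G.Adj b d → False)
    (hC5 : NoC5 G) : IsSplit G := by
  classical
  -- Among the maximum cliques, $K$ leaves the fewest edges outside; its complement turns out to be
  -- stable.
  obtain ⟨K, hK, hmax, hmin⟩ := exists_maximum_clique G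
  have hnon : ∀ x ∉ K, ∃ u ∈ K, ¬ G.Adj x u := by
    intro x hx
    by_contra! h
    have := hmax (insert x K) (hK.insert fun u hu _ => h u hu)
    rw [Set.ncard_insert_of_notMem hx] at this
    omega
  have key : ∀ x y, x ∉ K → y ∉ K → G.Adj x y → (∀ u ∈ K, ¬ G.Adj x u → ¬ G.Adj y u) → False := by
    intro x y hx hy hxy hsub
    obtain ⟨u, hu, hxu⟩ := hnon x hx
    have hyu := hsub u hu hxu
    have huniq : ∀ w ∈ K, w ≠ u → G.Adj x w := by
      intro w hw hwu
      by_contra hxw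
      exact h2K2 x y u w hxy (hK hu hw hwu.symm) hxu hxw hyu (hsub w hw hxw)
    have hK' : G.IsClique (insert x (K \ {u})) :=
      (hK.subset Set.sdiff_subset).insert fun w hw _ => huniq w hw.1 hw.2
    have hxK' : x ∉ K \ {u} := fun h => hx h.1
    have hcard : (insert x (K \ {u})).ncard = K.ncard := by
      rw [Set.ncard_insert_of_notMem hxK', Set.ncard_sdiff_singleton_add_one hu]
    obtain ⟨w, hw, hwu, hyw⟩ : ∃ w ∈ K, w ≠ u ∧ ¬ G.Adj y w := by
      by_contra! h
      have hy' : y ∉ insert x (K \ {u}) := by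
        rintro (h | h)
        exacts [hxy.ne h.symm, hy h.1]
      have := hmax (insert y (insert x (K \ {u}))) (hK'.insert fun w hw _ => by
        rcases hw with rfl | hw
        exacts [hxy.symm, h w hw.1 hw.2])
      rw [Set.ncard_insert_of_notMem hy', hcard] at this
      omega
    have hxw := huniq w hw hwu
    -- Exchanging $u$ for $x$ gives another maximum clique. Without such a $y'$, the transposition
    -- of $u$ and $x$ would inject its outside edges into those of $K$ while missing $(x,y)$,
    -- contradicting the choice of $K$.
    obtain ⟨y', hy', hy'x, huy', hxy'⟩ : ∃ y', y' ∉ K ∧ y' ≠ x ∧ G.Adj u y' ∧ ¬ G.Adj x y' := by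
      by_contra! h
      have hout : ∀ v, v ∉ insert x (K \ {u}) → v = u ∨ (v ≠ u ∧ v ≠ x ∧ v ∉ K) := by
        intro v hv
        simp only [Set.mem_insert_iff, Set.mem_sdiff, Set.mem_singleton_iff] at hv
        tauto
      have hux : u ≠ x := fun e => hx (e ▸ hu)
      have himg : Prod.map (Equiv.swap u x) (Equiv.swap u x) ''
          outsideEdges G (insert x (K \ {u})) ⊂ outsideEdges G K := by
        rw [Set.ssubset_iff_of_subset]
        · refine ⟨(x, y), ⟨hx, hy, hxy⟩, ?_⟩
          rintro ⟨⟨p, q⟩, ⟨-, -, hpq⟩, e⟩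
          simp only [Prod.map_apply, Prod.mk.injEq] at e hpq
          obtain ⟨e₁, e₂⟩ := e
          have hp : p = u := by
            rw [Equiv.swap_apply_eq_iff, Equiv.swap_apply_right] at e₁
            exact e₁
          have hq : q = y := by
            rw [Equiv.swap_apply_eq_iff, Equiv.swap_apply_of_ne_of_ne
              (ne_of_mem_of_not_mem hu hy).symm hxy.ne.symm] at e₂
            exact e₂
          subst hp hq
          exact hyu hpq.symm
        · rintro _ ⟨⟨p, q⟩, ⟨hp, hq, hpq⟩, rfl⟩
          simp only at hp hq hpq
          rcases hout p hp with rfl | ⟨hp₁, hp₂, hp₃⟩ <;>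
            rcases hout q hq with rfl | ⟨hq₁, hq₂, hq₃⟩
          · exact (hpq.ne rfl).elim
          · simp only [Prod.map_apply, Equiv.swap_apply_left,
              Equiv.swap_apply_of_ne_of_ne hq₁ hq₂]
            exact ⟨hx, hq₃, h q hq₃ hq₂ hpq⟩
          · simp only [Prod.map_apply, Equiv.swap_apply_left,
              Equiv.swap_apply_of_ne_of_ne hp₁ hp₂]
            exact ⟨hp₃, hx, (h p hp₃ hp₂ hpq.symm).symm⟩
          · simp only [Prod.map_apply, Equiv.swap_apply_of_ne_of_ne hq₁ hq₂,
              Equiv.swap_apply_of_ne_of_ne hp₁ hp₂]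
            exact ⟨hp₃, hq₃, hpq⟩
      have hlt := Set.ncard_lt_ncard himg (Set.toFinite _)
      rw [Set.ncard_image_of_injective _
        (Function.Injective.prodMap (Equiv.injective _) (Equiv.injective _))] at hlt
      have := hmin _ hK' hcard
      omega
    have huw : G.Adj u w := hK hu hw hwu.symm
    by_cases hyy' : G.Adj y y'
    · by_cases hwy' : G.Adj y' w
      · exact hC4 x y y' w hxy hyy' hwy' hxw.symm hy'x.symm (fun e => hy (e ▸ hw)) hxy' hyw
      · exact hC5 x y y' u w hxy hyy' huy'.symm huw hxw.symm hxy' hyu hwy' (fun h => hxu h.symm)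
          (fun h => hyw h.symm)
    · exact h2K2 x y u y' hxy huy' hxu hxy' hyu hyy'
  refine ⟨K, Kᶜ, disjoint_compl_right, Set.union_compl_self K, hK, fun x hx y hy _ hxy => ?_⟩
  by_cases h₁ : ∀ u ∈ K, ¬ G.Adj x u → ¬ G.Adj y u
  · exact key x y hx hy hxy h₁
  by_cases h₂ : ∀ u ∈ K, ¬ G.Adj y u → ¬ G.Adj x u
  · exact key y x hy hx hxy.symm h₂
  push Not at h₁ h₂
  obtain ⟨u, hu, hxu, hyu⟩ := h₁
  obtain ⟨w, hw, hyw, hxw⟩ := h₂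
  have huw : u ≠ w := by
    rintro rfl
    exact hyw hyu
  exact hC4 x y u w hxy hyu (hK hu hw huw) hxw.symm (fun e => hx (e ▸ hu)) (fun e => hy (e ▸ hw))
    hxu hyw

end Split

/-! ### Prime graphs with an induced pentagon -/

section Pentagon

variable {V : Type*} {G : SimpleGraph V}

/-- Adjacency matrix of the five-cycle. -/
def cycMat (i j : Fin 5) : Bool := j == i + 1 || i == j + 1

/-- The possible neighbourhoods of a vertex on an induced five-cycle. -/
def CycShape (b : Fin 5 → Bool) : Prop :=
  (∀ k, b k = true) ∨ (∀ k, b k = false) ∨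
    ∃ k, b (k + 1) = true ∧ b (k - 1) = true ∧ b (k + 2) = false ∧ b (k - 2) = false

instance (b : Fin 5 → Bool) : Decidable (CycShape b) := by
  unfold CycShape
  infer_instance

/-- The first two rules exclude a path formed by $v$ and four consecutive vertices of the pentagon.
The last two are the same rules in the complementary pentagon, where consecutive vertices differ by
two. -/
theorem cycShape_of_rules : ∀ b : Fin 5 → Bool,
    (∀ k, ¬ (b k = true ∧ b (k + 1) = false ∧ b (k + 2) = false ∧ b (k + 3) = false)) →
    (∀ k, ¬ (b k = true ∧ b (k - 1) = false ∧ b (k - 2) = false ∧ b (k - 3) = false)) →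
    (∀ k, ¬ (b k = false ∧ b (k + 2) = true ∧ b (k + 4) = true ∧ b (k + 6) = true)) →
    (∀ k, ¬ (b k = false ∧ b (k - 2) = true ∧ b (k - 4) = true ∧ b (k - 6) = true)) →
    CycShape b := by decide +kernel

theorem IsP5HouseFree.cycShape (hG : IsP5HouseFree G) {s : Fin 5 → V}
    (hs : ∀ i j, G.Adj (s i) (s j) ↔ cycMat i j = true) (v : V) {b : Fin 5 → Bool}
    (hb : ∀ k, b k = true ↔ G.Adj v (s k)) : CycShape b := by
  have hb' : ∀ k, b k = false → ¬ G.Adj v (s k) := fun k h h' => by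
    rw [← hb k, h] at h'
    exact absurd h' (by decide)
  have e : ∀ i j, cycMat i j = true → G.Adj (s i) (s j) := fun i j => (hs i j).2
  have n : ∀ i j, cycMat i j = false → ¬ G.Adj (s i) (s j) := fun i j h => by
    rw [hs i j, h]
    decide
  refine cycShape_of_rules b ?_ ?_ ?_ ?_
  · rintro k ⟨h₀, h₁, h₂, h₃⟩
    exact hG.no_path ((hb k).1 h₀) (e k (k + 1) (by clear * - k; revert k; decide))
      (e (k + 1) (k + 2) (by clear * - k; revert k; decide))
      (e (k + 2) (k + 3) (by clear * - k; revert k; decide))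
      (hb' _ h₁) (hb' _ h₂) (hb' _ h₃) (n _ _ (by clear * - k; revert k; decide))
      (n _ _ (by clear * - k; revert k; decide)) (n _ _ (by clear * - k; revert k; decide))
  · rintro k ⟨h₀, h₁, h₂, h₃⟩
    exact hG.no_path ((hb k).1 h₀) (e k (k - 1) (by clear * - k; revert k; decide))
      (e (k - 1) (k - 2) (by clear * - k; revert k; decide))
      (e (k - 2) (k - 3) (by clear * - k; revert k; decide))
      (hb' _ h₁) (hb' _ h₂) (hb' _ h₃) (n _ _ (by clear * - k; revert k; decide))
      (n _ _ (by clear * - k; revert k; decide)) (n _ _ (by clear * - k; revert k; decide))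
  · rintro k ⟨h₀, h₁, h₂, h₃⟩
    exact hG.no_house ((hb _).1 h₃) (e (k + 6) k (by clear * - k; revert k; decide))
      (e k (k + 4) (by clear * - k; revert k; decide)) ((hb _).1 h₂).symm ((hb _).1 h₁).symm
      (e (k + 2) (k + 6) (by clear * - k; revert k; decide)) (hb' _ h₀)
      (n (k + 6) (k + 4) (by clear * - k; revert k; decide))
      (n (k + 2) k (by clear * - k; revert k; decide))
      (n (k + 2) (k + 4) (by clear * - k; revert k; decide))
  · rintro k ⟨h₀, h₁, h₂, h₃⟩
    exact hG.no_house ((hb _).1 h₃) (e (k - 6) k (by clear * - k; revert k; decide))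
      (e k (k - 4) (by clear * - k; revert k; decide)) ((hb _).1 h₂).symm ((hb _).1 h₁).symm
      (e (k - 2) (k - 6) (by clear * - k; revert k; decide)) (hb' _ h₀)
      (n (k - 6) (k - 4) (by clear * - k; revert k; decide))
      (n (k - 2) k (by clear * - k; revert k; decide))
      (n (k - 2) (k - 4) (by clear * - k; revert k; decide))

theorem cycMat_irrefl : ∀ k, cycMat k k = false := by decide

theorem cycShape_update_all : ∀ (b : Fin 5 → Bool) (j : Fin 5) (c : Bool),
    CycShape (Function.update b j c) → (∀ k, b k = true) → c = true := by decide +kernel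

theorem cycShape_update_none : ∀ (b : Fin 5 → Bool) (j : Fin 5) (c : Bool),
    CycShape (Function.update b j c) → (∀ k, b k = false) → c = false := by decide +kernel

theorem cycShape_update_twin : ∀ (b : Fin 5 → Bool) (k : Fin 5),
    b (k + 1) = true ∧ b (k - 1) = true ∧ b (k + 2) = false ∧ b (k - 2) = false →
    ∀ (j : Fin 5) (c : Bool), CycShape (Function.update b j c) → j ≠ k → c = cycMat k j := by
  decide +kernel

/-- On `X`, the graph `G` is obtained from a five-cycle by blowing up its vertices. -/
def IsBlowup (G : SimpleGraph V) (X : Set V) (φ : V → Fin 5) : Prop :=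
  (∀ x ∈ X, ∀ y ∈ X, φ x ≠ φ y → (G.Adj x y ↔ cycMat (φ x) (φ y) = true)) ∧
    ∀ k, ∃ x ∈ X, φ x = k

theorem IsBlowup.transversal {X : Set V} {φ : V → Fin 5} (h : IsBlowup G X φ) {s : Fin 5 → V}
    (hs : ∀ k, s k ∈ X ∧ φ (s k) = k) (i j : Fin 5) : G.Adj (s i) (s j) ↔ cycMat i j = true := by
  by_cases hij : i = j
  · subst hij
    rw [cycMat_irrefl]
    exact iff_of_false (fun h => h.ne rfl) (by decide)
  · rw [h.1 _ (hs i).1 _ (hs j).1 (by rwa [(hs i).2, (hs j).2]), (hs i).2, (hs j).2]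

/-- Replacing one vertex of a transversal pentagon by another vertex of its class gives a pentagon
again, and the shape of the neighbourhood of $v$ cannot change type. If $v$ looks like a twin of
vertex $k$, it can be added to class $k$, against maximality. -/
theorem IsBlowup.homogeneous (hG : IsP5HouseFree G) {X : Set V}
    (hX : Maximal (fun X => ∃ φ, IsBlowup G X φ) X) {v : V} (hv : v ∉ X) :
    (∀ x ∈ X, G.Adj v x) ∨ ∀ x ∈ X, ¬ G.Adj v x := by
  classical
  obtain ⟨φ, hφ⟩ := hX.1
  choose s hs using hφ.2
  set b : Fin 5 → Bool := fun k => decide (G.Adj v (s k)) with hb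
  have hshape : CycShape b := hG.cycShape (hφ.transversal hs) v fun k => by simp [hb]
  have hupd : ∀ x ∈ X, CycShape (Function.update b (φ x) (decide (G.Adj v x))) := by
    intro x hx
    refine hG.cycShape (s := Function.update s (φ x) x) (hφ.transversal fun k => ?_) v fun k => ?_
    · by_cases hk : k = φ x
      · subst hk
        simpa using hx
      · simpa [Function.update_of_ne hk] using hs k
    · by_cases hk : k = φ x
      · subst hk
        simp
      · simp [Function.update_of_ne hk, hb]
  rcases hshape with h | h | ⟨k, h⟩
  · left
    intro x hx
    simpa using cycShape_update_all b _ _ (hupd x hx) h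
  · right
    intro x hx
    simpa using cycShape_update_none b _ _ (hupd x hx) h
  · refine absurd (hX.2 ⟨Function.update φ v k, ?_, ?_⟩ (Set.subset_insert v X)
      (Set.mem_insert v X)) hv
    · have hne : ∀ x ∈ X, x ≠ v := fun x hx e => hv (e ▸ hx)
      have hvx : ∀ x ∈ X, φ x ≠ k → (G.Adj v x ↔ cycMat k (φ x) = true) := by
        intro x hx hxk
        rw [← cycShape_update_twin b k h _ _ (hupd x hx) hxk, decide_eq_true_eq]
      have hsymm : ∀ i j, cycMat i j = cycMat j i := by decide
      rintro x (rfl | hx) y (rfl | hy) hxy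
      · exact absurd rfl hxy
      · rw [Function.update_self, Function.update_of_ne (hne y hy)] at hxy ⊢
        exact hvx y hy hxy.symm
      · rw [Function.update_self, Function.update_of_ne (hne x hx)] at hxy ⊢
        rw [G.adj_comm, hsymm]
        exact hvx x hx hxy
      · rw [Function.update_of_ne (hne x hx), Function.update_of_ne (hne y hy)] at hxy ⊢
        exact hφ.1 x hx y hy hxy
    · intro j
      obtain ⟨x, hx, hxj⟩ := hφ.2 j
      exact ⟨x, Or.inr hx, by rw [Function.update_of_ne (ne_of_mem_of_not_mem hx hv), hxj]⟩

/-- Fouquet's theorem: a prime free graph with an induced pentagon is a pentagon. -/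
theorem isPentagon_of_prime [Finite V] (hG : IsP5HouseFree G) (hprime : IsPrime G)
    {s : Fin 5 → V} (hs : ∀ i j, G.Adj (s i) (s j) ↔ cycMat i j = true) : IsPentagon G := by
  classical
  have hsep : ∀ i j : Fin 5, (∀ k, cycMat i k = cycMat j k) → i = j := by decide
  have hinj : Function.Injective s := fun i j hij => hsep i j fun k => by
    rw [Bool.eq_iff_iff, ← hs, ← hs, hij]
  have h₀ : ∃ φ, IsBlowup G (Set.range s) φ := by
    refine ⟨Function.invFun s, ?_, fun k => ⟨s k, ⟨k, rfl⟩, Function.leftInverse_invFun hinj k⟩⟩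
    rintro _ ⟨i, rfl⟩ _ ⟨j, rfl⟩ -
    rw [Function.leftInverse_invFun hinj, Function.leftInverse_invFun hinj, hs]
  obtain ⟨X, -, hX⟩ := Finite.exists_le_maximal (p := fun X => ∃ φ, IsBlowup G X φ) h₀
  obtain ⟨φ, hφ⟩ := id hX.1
  have hXu : X = Set.univ := by
    by_contra hne
    obtain ⟨x, hx, hx0⟩ := hφ.2 0
    obtain ⟨y, hy, hy1⟩ := hφ.2 1
    have hxy : x ≠ y := by
      rintro rfl
      exact absurd (hx0.symm.trans hy1) (by decide)
    obtain ⟨v, hv, ⟨p, hp, hvp⟩, q, hq, hvq⟩ := hprime X ⟨x, hx, y, hy, hxy⟩ hne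
    rcases IsBlowup.homogeneous hG hX hv with h | h
    exacts [hvq (h q hq), h p hp hvp]
  have hadj : ∀ x y, φ x ≠ φ y → (G.Adj x y ↔ cycMat (φ x) (φ y) = true) := fun x y =>
    hφ.1 x (hXu ▸ Set.mem_univ x) y (hXu ▸ Set.mem_univ y)
  -- Each class of the blow-up is homogeneous, so primality reduces it to one vertex.
  have hφinj : Function.Injective φ := by
    intro x y hxy
    by_contra hne
    have h01 : ∀ k : Fin 5, k + 1 ≠ k := by decide
    obtain ⟨v, hv, ⟨p, hp, hvp⟩, q, hq, hvq⟩ := hprime {w | φ w = φ x} ⟨x, rfl, y, hxy.symm, hne⟩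
      fun h => by
        obtain ⟨w, -, hw⟩ := hφ.2 (φ x + 1)
        have : φ w = φ x := (h ▸ Set.mem_univ w : w ∈ {w | φ w = φ x})
        exact h01 _ (hw.symm.trans this)
    have hp' : φ p = φ x := hp
    have hq' : φ q = φ x := hq
    have hv' : φ v ≠ φ x := hv
    rw [hadj v p (by rwa [hp']), hp'] at hvp
    rw [hadj v q (by rwa [hq']), hq'] at hvq
    exact hvq hvp
  have hφsurj : Function.Surjective φ := fun k => by
    obtain ⟨x, -, hx⟩ := hφ.2 k
    exact ⟨x, hx⟩
  have hcyc : ∀ i j, (SimpleGraph.cycleGraph 5).Adj i j ↔ cycMat i j = true := by decide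
  refine ⟨⟨Equiv.ofBijective φ ⟨hφinj, hφsurj⟩, fun {x y} => ?_⟩⟩
  rw [hcyc]
  change cycMat (φ x) (φ y) = true ↔ G.Adj x y
  by_cases hxy : x = y
  · subst hxy
    rw [cycMat_irrefl]
    exact iff_of_false (by decide) fun h => h.ne rfl
  · exact (hadj x y (hφinj.ne hxy)).symm

theorem exists_cycle_of_not_noC5 (h : ¬ NoC5 G) :
    ∃ s : Fin 5 → V, ∀ i j, G.Adj (s i) (s j) ↔ cycMat i j = true := by
  unfold NoC5 at h
  push Not at h
  obtain ⟨a, b, c, d, e, ab, bc, cd, de, ea, ac, bd, ce, da, eb, -⟩ := h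
  refine ⟨![a, b, c, d, e], fun i j => ?_⟩
  have ab' := ab.symm
  have bc' := bc.symm
  have cd' := cd.symm
  have de' := de.symm
  have ea' := ea.symm
  have ac' := fun h => ac (G.symm.symm _ _ h)
  have bd' := fun h => bd (G.symm.symm _ _ h)
  have ce' := fun h => ce (G.symm.symm _ _ h)
  have da' := fun h => da (G.symm.symm _ _ h)
  have eb' := fun h => eb (G.symm.symm _ _ h)
  fin_cases i <;> fin_cases j <;> simp [cycMat] <;> assumption

end Pentagon

/-! ### Homogeneous sets and substitution -/

section Homogeneous

variable {V : Type*} {G : SimpleGraph V}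

/-- For a homogeneous set $X$, being full to $X$ amounts to being adjacent to one fixed $x_1\in X$.
So the quotient, with $X$ contracted to `Sum.inr true`, is isomorphic to an induced subgraph of $G$
and inherits freeness. -/
theorem obtainedBySubstitution_of_not_prime [Finite V] (hG : IsP5HouseFree G)
    (h : ¬ IsPrime G) : ObtainedBySubstitution (IsSmallerFree V) G := by
  unfold IsPrime at h
  push Not at h
  obtain ⟨X, hX, hXu, hmod⟩ := h
  obtain ⟨x₁, hx₁, x₂, hx₂, hne⟩ := id hX
  have hfull : ∀ v ∉ X, (FullTo G X v ↔ G.Adj v x₁) := fun v hv =>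
    ⟨fun h => h.2 x₁ hx₁, fun h => ⟨hv, hmod v hv ⟨x₁, hx₁, h⟩⟩⟩
  have hG' := hG
  rw [isP5HouseFree_iff] at hG'
  have hdiff : ((Sum.inl '' Xᶜ ∪ {Sum.inr true}) \ {Sum.inr true} : Set (V ⊕ Bool)) =
      Sum.inl '' Xᶜ := by
    ext x
    rcases x with x | (_ | _) <;> simp
  refine ⟨V ⊕ Bool, inferInstance, (extGraph G X).induce (Sum.inl '' X),
    (extGraph G X).induce (Sum.inl '' Xᶜ ∪ {Sum.inr true}),
    (extGraph G X).induce (Set.range Sum.inl), Sum.inr true,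
    ⟨?_, Or.inr rfl, ?_, ?_, ?_, ?_, ?_⟩, ?_, ⟨?_, ?_⟩, ⟨?_, ?_⟩⟩
  · rw [SimpleGraph.Subgraph.induce_verts, SimpleGraph.Subgraph.induce_verts, Set.disjoint_left]
    rintro _ ⟨x, hx, rfl⟩ (⟨y, hy, e⟩ | e)
    · exact hy (Sum.inl_injective e ▸ hx)
    · exact absurd e (by simp)
  · simp only [SimpleGraph.Subgraph.induce_verts]
    rw [hdiff, ← Set.image_union, Set.union_compl_self, Set.image_univ]
  · exact induce_induce_of_subset _ (Set.image_subset_range _ _)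
  · simp only [SimpleGraph.Subgraph.induce_verts]
    rw [hdiff, induce_induce_of_subset _ (Set.image_subset_range _ _),
      deleteVerts_induce_union_singleton _ (by simp)]
  · simp only [SimpleGraph.Subgraph.induce_verts, hdiff]
    rintro _ ⟨w, hw, rfl⟩ hadj _ rfl _ ⟨x, hx, rfl⟩
    have hw' : FullTo G X w := hadj.2.2
    exact ⟨⟨w, rfl⟩, ⟨x, rfl⟩, hw'.2 x hx⟩
  · simp only [SimpleGraph.Subgraph.induce_verts, hdiff]
    rintro _ ⟨w, hw, rfl⟩ hadj _ rfl _ ⟨x, hx, rfl⟩ hadj'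
    exact hadj ⟨Or.inl ⟨w, hw, rfl⟩, Or.inr rfl, hw, hmod w hw ⟨x, hx, hadj'.2.2⟩⟩
  · refine ⟨⟨Equiv.ofInjective Sum.inl Sum.inl_injective, fun {x y} => ?_⟩⟩
    change ((extGraph G X).induce (Set.range Sum.inl)).Adj (Sum.inl x) (Sum.inl y) ↔ _
    rw [SimpleGraph.Subgraph.induce_adj]
    simp [extGraph, extAdj]
  · rw [SimpleGraph.Subgraph.induce_verts, Nat.card_coe_set_eq,
      Set.ncard_image_of_injective _ Sum.inl_injective, ← Set.ncard_univ]
    exact Set.ncard_lt_ncard (Set.ssubset_univ_iff.2 hXu)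
  · rw [isP5HouseFree_coe_iff]
    intro M hM f hf hcopy
    choose g hg using hf
    refine hG' M hM g fun i j => ?_
    rw [← hcopy i j, SimpleGraph.Subgraph.induce_adj, ← (hg i).2, ← (hg j).2]
    exact ⟨fun h => ⟨⟨_, (hg i).1, rfl⟩, ⟨_, (hg j).1, rfl⟩, h⟩, fun h => h.2.2⟩
  · exact card_image_inl_union_lt _ _ hne (fun h => h hx₁) (fun h => h hx₂)
  · rw [isP5HouseFree_coe_iff]
    intro M hM f hf hcopy
    refine hG' M hM (fun i => Sum.elim id (fun _ => x₁) (f i)) fun i j => ?_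
    rw [← hcopy i j, SimpleGraph.Subgraph.induce_adj]
    have hi := hf i
    have hj := hf j
    rw [SimpleGraph.Subgraph.induce_verts] at hi hj
    simp only [hi, hj, true_and]
    rcases hi with ⟨x, hx, e⟩ | e <;> rcases hj with ⟨y, hy, e'⟩ | e'
    · rw [← e, ← e']; rfl
    · rw [← e, e']
      exact (hfull x hx).symm
    · rw [← e', e, G.adj_comm]
      exact (hfull y hy).symm
    · rw [e, e']
      exact iff_of_false (fun h => h.ne rfl) id

end Homogeneous

/-! ### Invariance under complementation -/

section Complement

variable {V : Type*} {G : SimpleGraph V}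

theorem IsPrime.compl (h : IsPrime G) : IsPrime Gᶜ := by
  intro X hX hXu
  obtain ⟨v, hv, ⟨x, hx, hvx⟩, y, hy, hvy⟩ := h X hX hXu
  refine ⟨v, hv, ⟨y, hy, ?_⟩, x, hx, ?_⟩
  · exact (SimpleGraph.compl_adj _ _ _).2 ⟨fun e => hv (e ▸ hy), hvy⟩
  · exact fun h => ((SimpleGraph.compl_adj _ _ _).1 h).2 hvx

theorem NoC5.compl (h : NoC5 G) : NoC5 Gᶜ := by
  -- Non-adjacency in the complement gives adjacency in $G$ only for distinct vertices; $z$ tells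
  -- them apart.
  have key : ∀ {x y z : V}, ¬ Gᶜ.Adj x y → Gᶜ.Adj x z → ¬ Gᶜ.Adj y z → G.Adj x y := by
    intro x y z hxy hxz hyz
    by_contra hn
    refine hxy ((SimpleGraph.compl_adj _ _ _).2 ⟨?_, hn⟩)
    rintro rfl
    exact hyz hxz
  have key' : ∀ {x y : V}, Gᶜ.Adj x y → ¬ G.Adj x y := fun h =>
    ((SimpleGraph.compl_adj _ _ _).1 h).2
  intro a b c d e ab bc cd de ea ac bd ce da eb
  exact h a c e b d (key ac ea.symm ce) (key ce bc.symm (fun h => eb h)) (key eb de.symm bd)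
    (key bd ab.symm (fun h => da h)) (key da cd.symm ac) (key' ea.symm) (key' bc.symm)
    (key' de.symm) (key' ab.symm) (key' cd.symm)

end Complement

end P5House

/-! ### The main theorem -/

theorem theorem5p1 {V : Type*} [Finite V] (G : SimpleGraph V) :
    P5House.IsP5HouseFree G ↔
      P5House.IsSplit G ∨
      P5House.IsPentagon G ∨
      P5House.ObtainedBySubstitution (P5House.IsSmallerFree V) G ∨
      (P5House.ObtainedBySplitUnification (P5House.IsSmallerFree V) G ∨
        P5House.ObtainedBySplitUnification (P5House.IsSmallerFree V) Gᶜ) := by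
  constructor
  · intro hG
    by_cases hprime : P5House.IsPrime G
    swap
    · exact Or.inr (Or.inr (Or.inl (P5House.obtainedBySubstitution_of_not_prime hG hprime)))
    by_cases hC5 : P5House.NoC5 G
    swap
    · obtain ⟨s, hs⟩ := P5House.exists_cycle_of_not_noC5 hC5
      exact Or.inr (Or.inl (P5House.isPentagon_of_prime hG hprime hs))
    by_cases hsplit : P5House.IsSplit G
    · exact Or.inl hsplit
    refine Or.inr (Or.inr (Or.inr ?_))
    by_contra hno
    refine hsplit (P5House.isSplit_of_forbidden (fun a b c d hab hcd hac had hbc hbd => ?_)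
      (fun a b c d hab hbc hcd hda hac hbd hac' hbd' => ?_) hC5)
    · obtain ⟨Z, hZ | hZ⟩ := P5House.exists_isDivide hG hC5 hprime hab hcd hac had hbc hbd
      · exact hno (Or.inl (hZ.obtainedBySplitUnification hG))
      · exact hno (Or.inr (hZ.obtainedBySplitUnification hG.compl))
    -- The diagonals $ac$ and $bd$ of an induced four-cycle form an induced $2K_2$ in the
    -- complement.
    · have hn : ∀ {x y : V}, G.Adj x y → ¬ Gᶜ.Adj x y := fun h h' =>
        ((SimpleGraph.compl_adj _ _ _).1 h').2 h
      obtain ⟨Z, hZ | hZ⟩ := P5House.exists_isDivide hG.compl hC5.compl hprime.compl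
        ((SimpleGraph.compl_adj _ _ _).2 ⟨hac, hac'⟩) ((SimpleGraph.compl_adj _ _ _).2 ⟨hbd, hbd'⟩)
        (hn hab) (hn hda.symm) (hn hbc.symm) (hn hcd)
      · exact hno (Or.inr (hZ.obtainedBySplitUnification hG.compl))
      · rw [compl_compl] at hZ
        exact hno (Or.inl (hZ.obtainedBySplitUnification hG))
  · rintro (h | h | h | h | h)
    · exact h.free
    · exact h.free
    · exact h.free
    · exact h.free
    · exact P5House.isP5HouseFree_compl_iff.1 h.free
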